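/- Let $n\ge 2$, let $\Omega\subset\mathbb R^n$ be a bounded open set, and let $f\in H^{-1}(\Omega)=(H^1_0(\Omega))'$. Let $a=(a_{ij})$, $b=(b_{ij})$ be constant real matrices which are elliptic, i.e. $\sum_{ij}a_{ij}\xi_i\xi_j\ge\gamma|\xi|^2$ and $\sum_{ij}b_{ij}\xi_i\xi_j\ge\gamma'|\xi|^2$ for all $\xi\in\mathbb R^n$, with constants $\gamma,\gamma'>0$, and let $A,B$ be the corresponding second order operators, understood weakly: $\langle Au,\varphi\rangle=\sum_{ij}\int a_{ij}\,\partial_ju\,\partial_i\varphi\,dx$, and similarly for $B$. Let $\mathcal M_0(\Omega)$ be the set of Borel measures on $\Omega$ with values in $[0,+\infty]$ that vanish on the sets of zero (harmonic) capacity; every $u\in H^1_0(\Omega)$ is identified with its quasi-continuous representative. For $\mu\in\mathcal M_0(\Omega)$ and $g\in H^{-1}(\Omega)$, a function $w$ is a solution of $Aw+\mu w=g$ if $w\in H^1_0(\Omega)\cap L^2_\mu(\Omega)$ and $$\sum_{ij}\int_\Omega a_{ij}\,\partial_jw\,\partial_i\varphi\,dx+\int_\Omega w\varphi\,d\mu=\langle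 g,\varphi\rangle\qquad\text{for all }\varphi\in H^1_0(\Omega)\cap L^2_\mu(\Omega).$$ Functions $z\in H^1_0(\Omega)$ act as elements of $H^{-1}(\Omega)$ through $\varphi\mapsto\int_\Omega z\varphi\,dx$. Let $(U_k)$ be a sequence of open subsets of $\Omega$ and let $\mu_A,\mu_B\in\mathcal M_0(\Omega)$ be limit measures associated with this same sequence and with $A$ and $B$ respectively. That is, for every $g\in H^{-1}(\Omega)$, the solutions $z_k\in H^1_0(U_k)$ of $Az_k=g$ in $H^{-1}(U_k)$ converge weakly in $H^1_0(\Omega)$ to the solution $z$ of $Az+\mu_Az=g$, and likewise with $B,\mu_B$ in place of $A,\mu_A$. **Theorem 5.1.** For every $g\in H^{-1}(\Omega)$ the problem $Aw+\mu_Aw=g$ has exactly one solution $w=:R_Ag$, and $R_A$ is injective on $H^1_0(\Omega)\cap L^2_{\mu_A}(\Omega)$. Hence the space $V_A=R_A\big(H^1_0(\Omega)\cap L^2_{\mu_A}(\Omega)\big)$ and the inverse operator $\Lambda_{\mu_A}:V_A\to H^1_0(\Omega)\cap L^2_{\mu_A}(\Omega)$, $\Lambda_{\mu_A}w=z$ iff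 $w=R_Az$, are well defined. The same holds for $B,\mu_B$, which gives $R_B,V_B,\Lambda_{\mu_B}$. Moreover, a function $u\in H^1_0(\Omega)\cap L^2_{\mu_A}(\Omega)$ satisfies $$u\in V_A,\qquad \int_\Omega\Lambda_{\mu_B}\varphi\;\Lambda_{\mu_A}u\,dx=\langle f,\varphi\rangle\quad\text{for all }\varphi\in V_B,$$ if and only if there is a function $v$ such that $$\begin{cases}Au+\mu_Au=v,\quad u\in H^1_0(\Omega)\cap L^2_{\mu_A}(\Omega),\\ Bv+\mu_Bv=f,\quad v\in H^1_0(\Omega)\cap L^2_{\mu_B}(\Omega).\end{cases}$$ -/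

import Mathlib

open MeasureTheory Filter Topology
open scoped ENNReal ContDiff

noncomputable section

namespace RelaxedDirichlet

/-- The Euclidean space `ℝⁿ`. -/
abbrev RSpace (n : ℕ) := EuclideanSpace ℝ (Fin n)

/-- Pairs (function, vector field) in `L²(ℝⁿ) × L²(ℝⁿ; ℝⁿ)`, with the Hilbert norm
`‖(u, G)‖² = ∫ |u|² + ∫ |G|²`. On pairs `(u, ∇u)` this is the `H¹` norm. -/
abbrev L2Pair (n : ℕ) :=
  WithLp 2 (Lp ℝ 2 (volume : Measure (RSpace n)) × Lp (RSpace n) 2 (volume : Measure (RSpace n)))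

variable {n : ℕ}

/-- The pairs `(φ, ∇φ)` with `φ` a smooth function with compact support contained in `U`. -/
def testPairs (U : Set (RSpace n)) : Submodule ℝ (L2Pair n) where
  carrier := {p | ∃ φ : RSpace n → ℝ, ContDiff ℝ ∞ φ ∧ HasCompactSupport φ ∧ tsupport φ ⊆ U ∧
    p.fst =ᵐ[volume] φ ∧ p.snd =ᵐ[volume] gradient φ}
  zero_mem' := by
    refine ⟨0, contDiff_const, HasCompactSupport.zero, by simp [tsupport], Lp.coeFn_zero _ _ _, ?_⟩
    filter_upwards [Lp.coeFn_zero (RSpace n) 2 (volume : Measure (RSpace n))] with x hx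
    have h : gradient (0 : RSpace n → ℝ) x = 0 := by
      simp [gradient]
    rw [h]
    exact hx
  add_mem' := by
    rintro p q ⟨φ, h1, h2, h3, h4, h5⟩ ⟨ψ, k1, k2, k3, k4, k5⟩
    refine ⟨φ + ψ, h1.add k1, h2.add k2, (tsupport_add φ ψ).trans (Set.union_subset h3 k3), ?_, ?_⟩
    · filter_upwards [Lp.coeFn_add p.fst q.fst, h4, k4] with x hx e1 e2
      rw [WithLp.add_fst, hx, Pi.add_apply, Pi.add_apply, e1, e2]
    · filter_upwards [Lp.coeFn_add p.snd q.snd, h5, k5] with x hx e1 e2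
      rw [WithLp.add_snd, hx, Pi.add_apply, e1, e2]
      have d1 := (h1.differentiable (by simp)).differentiableAt (x := x)
      have d2 := (k1.differentiable (by simp)).differentiableAt (x := x)
      simp [gradient, fderiv_add d1 d2]
  smul_mem' := by
    rintro c p ⟨φ, h1, h2, h3, h4, h5⟩
    refine ⟨c • φ, contDiff_const.smul h1, h2.smul_left (f := fun _ => c),
      (tsupport_smul_subset_right (fun _ => c) φ).trans h3, ?_, ?_⟩
    · filter_upwards [Lp.coeFn_smul c p.fst, h4] with x hx e1
      rw [WithLp.smul_fst, hx, Pi.smul_apply, Pi.smul_apply, e1]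
    · filter_upwards [Lp.coeFn_smul c p.snd, h5] with x hx e1
      rw [WithLp.smul_snd, hx, Pi.smul_apply, e1]
      have d1 := (h1.differentiable (by simp)).differentiableAt (x := x)
      simp [gradient, fderiv_const_smul d1]

/-- The Sobolev space `H¹₀(U)`: the closure in the `H¹` norm of the smooth functions with compact
support in `U`. A function is represented together with its weak gradient (which it determines),
and is extended by zero outside `U`, so that `H¹₀(U) ≤ H¹₀(V)` whenever `U ⊆ V`. -/
def H10 (U : Set (RSpace n)) : Submodule ℝ (L2Pair n) := (testPairs U).topologicalClosure

/-- The function underlying an element of `H¹₀(Ω)`, defined almost everywhere. -/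
def fn {Ω : Set (RSpace n)} (u : H10 Ω) : RSpace n → ℝ := (u : L2Pair n).fst

/-- The weak gradient of an element of `H¹₀(Ω)`. -/
def grad {Ω : Set (RSpace n)} (u : H10 Ω) : RSpace n → RSpace n := (u : L2Pair n).snd

/-- `H⁻¹(Ω)`, the dual of `H¹₀(Ω)`. -/
abbrev Hdual (Ω : Set (RSpace n)) := StrongDual ℝ (H10 Ω)

/-- The functional `φ ↦ ∫ z φ dx` in `H⁻¹(Ω)` given by `z ∈ H¹₀(Ω)`, as an inner product in
`L²(ℝⁿ)`; see `l2Functional_apply`. -/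
def l2Functional {Ω : Set (RSpace n)} (z : H10 Ω) : Hdual Ω :=
  (innerSL ℝ (z : L2Pair n).fst).comp ((WithLp.fstL 2 ℝ _ _).comp (H10 Ω).subtypeL)

theorem l2Functional_apply {Ω : Set (RSpace n)} (z φ : H10 Ω) :
    l2Functional z φ = ∫ x, fn z x * fn φ x := by
  have : l2Functional z φ = inner ℝ (z : L2Pair n).fst (φ : L2Pair n).fst := rfl
  rw [this, L2.inner_def]
  simp only [fn, RCLike.inner_apply, conj_trivial, mul_comm]

/-- Elements of `H¹₀(Ω)` vanish almost everywhere outside `Ω`. -/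
theorem fn_eq_zero {Ω : Set (RSpace n)} (u : H10 Ω) : ∀ᵐ x ∂volume.restrict Ωᶜ, fn u x = 0 := by
  let T : L2Pair n →L[ℝ] Lp ℝ 2 ((volume : Measure (RSpace n)).restrict Ωᶜ) :=
    (LpToLpRestrictCLM (RSpace n) ℝ ℝ volume 2 Ωᶜ).comp (WithLp.fstL 2 ℝ _ _)
  have key : ∀ p : L2Pair n, T p = 0 ↔ ∀ᵐ x ∂volume.restrict Ωᶜ, p.fst x = 0 := by
    intro p
    have e : T p =ᵐ[volume.restrict Ωᶜ] p.fst := LpToLpRestrictCLM_coeFn ℝ Ωᶜ p.fst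
    rw [Lp.eq_zero_iff_ae_eq_zero]
    constructor
    · intro h
      filter_upwards [e, h] with x h1 h2
      rw [← h1, h2]
      rfl
    · intro h
      filter_upwards [e, h] with x h1 h2
      rw [h1, h2]
      rfl
  have hle : H10 Ω ≤ LinearMap.ker T.toLinearMap := by
    refine Submodule.topologicalClosure_minimal _ ?_ T.isClosed_ker
    rintro p ⟨φ, -, -, h3, h4, -⟩
    refine (key p).2 ?_
    have hm : ∀ᵐ x ∂(volume : Measure (RSpace n)).restrict Ωᶜ, x ∉ tsupport φ := by
      rw [ae_iff]
      simp only [not_not]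
      have hms : MeasurableSet (tsupport φ) := (isClosed_tsupport φ).measurableSet
      change (volume.restrict Ωᶜ) (tsupport φ) = 0
      rw [Measure.restrict_apply hms,
        Set.disjoint_iff_inter_eq_empty.1 (Set.disjoint_compl_right_iff_subset.2 h3)]
      exact measure_empty
    filter_upwards [ae_restrict_of_ae h4, hm] with x h1 h2
    rw [h1, image_eq_zero_of_notMem_tsupport h2]
  exact (key _).1 (hle u.2)

theorem l2Functional_apply' {Ω : Set (RSpace n)} (hΩ : MeasurableSet Ω) (z φ : H10 Ω) :
    l2Functional z φ = ∫ x in Ω, fn z x * fn φ x := by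
  rw [l2Functional_apply, setIntegral_eq_integral_of_ae_compl_eq_zero]
  have h := (ae_restrict_iff' hΩ.compl).1 (fn_eq_zero φ)
  filter_upwards [h] with x hx hxΩ
  rw [hx hxΩ, mul_zero]

/-- A matrix `a` of constant coefficients is elliptic. It represents the second order operator
`A` acting by `⟨Au, v⟩ = ∑ᵢⱼ ∫ aᵢⱼ ∂ⱼu ∂ᵢv dx`. -/
def Elliptic (a : Matrix (Fin n) (Fin n) ℝ) : Prop :=
  ∃ γ : ℝ, 0 < γ ∧ ∀ ξ : RSpace n, γ * ‖ξ‖ ^ 2 ≤ ∑ i, ∑ j, a i j * ξ i * ξ j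

/-- `∑ᵢⱼ ∫_U aᵢⱼ ∂ⱼu ∂ᵢv dx`. -/
def energy (a : Matrix (Fin n) (Fin n) ℝ) (U : Set (RSpace n)) {Ω : Set (RSpace n)}
    (u v : H10 Ω) : ℝ :=
  ∑ i, ∑ j, ∫ x in U, a i j * grad u x j * grad v x i

/-- The harmonic capacity relative to `Ω` of a subset `E` of `Ω`: the infimum of `∫_Ω |∇w|² dx`
over the `w ∈ H¹₀(Ω)` with `w ≥ 1` almost everywhere in a neighbourhood of `E`. -/
def cap (Ω E : Set (RSpace n)) : ℝ≥0∞ :=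
  ⨅ (w : H10 Ω) (_ : ∃ G : Set (RSpace n), IsOpen G ∧ E ⊆ G ∧ ∀ᵐ x ∂volume.restrict G, 1 ≤ fn w x),
    ∫⁻ x in Ω, ‖grad w x‖ₑ ^ 2

/-- `ψ` is quasi-continuous on `Ω`: its restriction to the complement of an open set of arbitrarily
small capacity is continuous. -/
def QuasiContinuousOn (Ω : Set (RSpace n)) (ψ : RSpace n → ℝ) : Prop :=
  ∀ ε : ℝ≥0∞, 0 < ε → ∃ G : Set (RSpace n), IsOpen G ∧ G ⊆ Ω ∧ cap Ω G < ε ∧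
    ContinuousOn ψ (Ω \ G)

/-- `ψ` is a quasi-continuous representative of `u`. -/
def IsQuasiContRep {Ω : Set (RSpace n)} (u : H10 Ω) (ψ : RSpace n → ℝ) : Prop :=
  QuasiContinuousOn Ω ψ ∧ ψ =ᵐ[volume.restrict Ω] fn u

/-- The quasi-continuous representative of `u ∈ H¹₀(Ω)` (unique up to sets of zero capacity). -/
def qc {Ω : Set (RSpace n)} (u : H10 Ω) : RSpace n → ℝ := Classical.epsilon (IsQuasiContRep u)

/-- `μ ∈ M₀(Ω)`: a nonnegative Borel measure on `Ω`, possibly taking the value `+∞`, which vanishes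
on the sets of zero capacity. A measure on `Ω` is represented by a measure on `ℝⁿ`, of which only
the restriction to `Ω` is ever used. -/
def IsM0 (Ω : Set (RSpace n)) (μ : Measure (RSpace n)) : Prop :=
  ∀ E : Set (RSpace n), E ⊆ Ω → MeasurableSet E → cap Ω E = 0 → μ E = 0

/-- The space `H¹₀(Ω) ∩ L²_μ(Ω)`. -/
def X (Ω : Set (RSpace n)) (μ : Measure (RSpace n)) : Set (H10 Ω) :=
  {u | MemLp (qc u) 2 (μ.restrict Ω)}

/-- `w ∈ H¹₀(Ω) ∩ L²_μ(Ω)` solves the relaxed Dirichlet problem `Aw + μw = g`. -/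
def IsRelaxedSol (a : Matrix (Fin n) (Fin n) ℝ) {Ω : Set (RSpace n)} (μ : Measure (RSpace n))
    (g : Hdual Ω) (w : H10 Ω) : Prop :=
  w ∈ X Ω μ ∧ ∀ φ ∈ X Ω μ, energy a Ω w φ + ∫ x in Ω, qc w x * qc φ x ∂μ = g φ

/-- The solution operator `R : H⁻¹(Ω) → H¹₀(Ω) ∩ L²_μ(Ω)`, sending `g` to the solution `w` of
`Aw + μw = g`. -/
def solOp (a : Matrix (Fin n) (Fin n) ℝ) {Ω : Set (RSpace n)} (μ : Measure (RSpace n))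
    (g : Hdual Ω) : H10 Ω :=
  Classical.epsilon (IsRelaxedSol a μ g)

/-- The space `V = R(H¹₀(Ω) ∩ L²_μ(Ω))`. -/
def V (a : Matrix (Fin n) (Fin n) ℝ) (Ω : Set (RSpace n)) (μ : Measure (RSpace n)) :
    Set (H10 Ω) :=
  {w | w ∈ X Ω μ ∧ ∃ z ∈ X Ω μ, w = solOp a μ (l2Functional z)}

/-- The operator `Λ : V → H¹₀(Ω) ∩ L²_μ(Ω)`, the inverse of the restriction of `R` to
`H¹₀(Ω) ∩ L²_μ(Ω)`. -/
def Lam (a : Matrix (Fin n) (Fin n) ℝ) {Ω : Set (RSpace n)} (μ : Measure (RSpace n)) :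
    H10 Ω → H10 Ω :=
  Function.invFunOn (fun z => solOp a μ (l2Functional z)) (X Ω μ)

/-- `z ∈ H¹₀(U)` solves `Az = g` in `H⁻¹(U)`, where `U ⊆ Ω` and `g ∈ H⁻¹(Ω)`. -/
def IsDirichletSol (a : Matrix (Fin n) (Fin n) ℝ) {Ω : Set (RSpace n)} (U : Set (RSpace n))
    (g : Hdual Ω) (z : H10 Ω) : Prop :=
  (z : L2Pair n) ∈ H10 U ∧ ∀ φ : H10 Ω, (φ : L2Pair n) ∈ H10 U → energy a U z φ = g φ

/-- `μ` is the limit measure associated with the operator `A` and the sequence of open sets `Uₖ`: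
for every `g ∈ H⁻¹(Ω)`, the solutions `zₖ ∈ H¹₀(Uₖ)` of `Azₖ = g` in `H⁻¹(Uₖ)` converge weakly in
`H¹₀(Ω)` to the solution of `Az + μz = g`. -/
def IsLimitMeasure (a : Matrix (Fin n) (Fin n) ℝ) (Ω : Set (RSpace n)) (U : ℕ → Set (RSpace n))
    (μ : Measure (RSpace n)) : Prop :=
  ∀ (g : Hdual Ω) (z : ℕ → H10 Ω), (∀ k, IsDirichletSol a (U k) g (z k)) →
    ∀ ℓ : Hdual Ω, Tendsto (fun k => ℓ (z k)) atTop (𝓝 (ℓ (solOp a μ g)))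

end RelaxedDirichlet

end

noncomputable section

namespace RelaxedDirichlet

variable {n : ℕ}

/-! ### Calculus for smooth functions with compact support -/

/-! The theorem rests on two facts: `R_B` is symmetric, and `X Ω μA = X Ω μB`. Let `u = R_A z`.
Every `φ ∈ V_B` is `R_B ζ` with `ζ ∈ X Ω μB`, so the single equation reads `∫ ζ z = f(R_B ζ)`. By
symmetry the right side is `∫ ζ (R_B f)`. If `z` belongs to `X Ω μB`, the choice `ζ = z - R_B f`
gives `z = R_B f`, which is the system with `v = z`; the converse is the same computation.

Symmetry (`apply_solOp_comm`) does not need a symmetric matrix: with constant coefficients two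
integrations by parts exchange `∂ᵢ` and `∂ⱼ`, so the form is symmetric on `H¹₀`
(`inner_matOp_comm`).

Equality of the two spaces (`X_subset_X`) is where the common sequence `Uₖ` enters. For `ψ ∈ X Ω μA`
let `u` solve `Au + μA u + t(u - ψ) = 0`. Then `u = R_A g` with `g = t(ψ - u)`, and both `g(u)` and
`t‖u - ψ‖²` are bounded independently of `t`. Hence `u` is a weak limit of elements of `H¹₀(Uₖ)`
with norms bounded independently of `t` (`exists_isBoundedLimit`), a property that mentions neither
operator nor measure. For such a `u`, testing the `B` problems in `Uₖ` gives `g(u)² ≤ C' g(R_B g)`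
for all `g` (`IsBoundedLimit.sq_le`). With `g = t(u - w)` and `w` the resolvent of `B + μB` at `u`,
this bounds `w` in `X Ω μB` and `t‖u - w‖²`. As `t → ∞`, the functions `w` tend to `ψ` in `L²` and
stay bounded in `X Ω μB`, so `ψ` lies there.

Existence, uniqueness and this last step need `H¹₀ ∩ L²_μ` to be a Hilbert space, that is, the graph
of `u ↦ qc u` to be closed. For this the theory of quasi-continuous representatives is built, up to
quasi-everywhere convergence of subsequences (`exists_tendsto_qc`). -/

theorem gradient_apply (φ : RSpace n → ℝ) (x : RSpace n) (i : Fin n) :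
    gradient φ x i = fderiv ℝ φ x (EuclideanSpace.single i 1) := by
  have h : inner ℝ (gradient φ x) (EuclideanSpace.single i (1 : ℝ))
      = fderiv ℝ φ x (EuclideanSpace.single i 1) := by
    rw [gradient, InnerProductSpace.toDual_symm_apply]
  rw [← h, EuclideanSpace.inner_single_right]
  simp

theorem contDiff_fderiv_apply {φ : RSpace n → ℝ} (h : ContDiff ℝ ∞ φ) (v : RSpace n) :
    ContDiff ℝ ∞ (fun x => fderiv ℝ φ x v) :=
  (h.fderiv_right (m := ∞) (by simp)).clm_apply contDiff_const

/-- Only one factor has compact support, so that the other may be a coordinate function, as in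
Poincaré's inequality. -/
theorem integral_fderiv_mul {φ η : RSpace n → ℝ} (h1 : ContDiff ℝ ∞ φ) (h2 : HasCompactSupport φ)
    (k1 : ContDiff ℝ ∞ η) (v : RSpace n) :
    ∫ x, φ x * fderiv ℝ η x v = -∫ x, fderiv ℝ φ x v * η x := by
  have c1 := (contDiff_fderiv_apply h1 v).continuous
  have c2 := (contDiff_fderiv_apply k1 v).continuous
  refine integral_mul_fderiv_eq_neg_fderiv_mul_of_integrable ?_ ?_ ?_ ?_ ?_
  · refine (c1.mul k1.continuous).integrable_of_hasCompactSupport ?_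
    exact (h2.fderiv_apply ℝ v).mul_right
  · exact (h1.continuous.mul c2).integrable_of_hasCompactSupport h2.mul_right
  · exact (h1.continuous.mul k1.continuous).integrable_of_hasCompactSupport h2.mul_right
  · exact fun x _ => (h1.differentiable (by simp)).differentiableAt
  · exact fun x _ => (k1.differentiable (by simp)).differentiableAt

theorem fderiv_fderiv_apply_comm {φ : RSpace n → ℝ} (h : ContDiff ℝ ∞ φ) (v w x : RSpace n) :
    fderiv ℝ (fun y => fderiv ℝ φ y v) x w = fderiv ℝ (fun y => fderiv ℝ φ y w) x v := by
  have hd : DifferentiableAt ℝ (fderiv ℝ φ) x :=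
    ((h.fderiv_right (m := ∞) (by simp)).differentiable (by simp)).differentiableAt
  have hs : IsSymmSndFDerivAt ℝ φ x := h.contDiffAt.isSymmSndFDerivAt (by
    simpa using WithTop.coe_le_coe.2 (le_top : (2 : ℕ∞) ≤ ⊤))
  have e : ∀ v w : RSpace n, fderiv ℝ (fun y => fderiv ℝ φ y v) x w
      = fderiv ℝ (fderiv ℝ φ) x w v := by
    intro v w
    rw [fderiv_clm_apply hd (differentiableAt_const v)]
    simp
  rw [e, e, hs.eq]

/-- Two integrations by parts and the symmetry of the second derivative of `ψ`. This is the source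
of the symmetry of the operators. -/
theorem integral_fderiv_mul_fderiv_comm {φ ψ : RSpace n → ℝ} (h1 : ContDiff ℝ ∞ φ)
    (h2 : HasCompactSupport φ) (k1 : ContDiff ℝ ∞ ψ) (v w : RSpace n) :
    ∫ x, fderiv ℝ φ x v * fderiv ℝ ψ x w = ∫ x, fderiv ℝ φ x w * fderiv ℝ ψ x v := by
  have e1 := integral_fderiv_mul h1 h2 (contDiff_fderiv_apply k1 w) v
  have e2 := integral_fderiv_mul h1 h2 (contDiff_fderiv_apply k1 v) w
  simp only [fderiv_fderiv_apply_comm k1 w v] at e1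
  linarith

theorem continuous_gradient {φ : RSpace n → ℝ} (h : ContDiff ℝ ∞ φ) :
    Continuous (gradient φ) :=
  (InnerProductSpace.toDual ℝ (RSpace n)).symm.continuous.comp
    (h.continuous_fderiv (by simp))

theorem tsupport_gradient_subset (φ : RSpace n → ℝ) : tsupport (gradient φ) ⊆ tsupport φ := by
  refine closure_minimal (fun x hx => ?_) (isClosed_tsupport φ)
  refine support_fderiv_subset ℝ (f := φ) ?_
  intro h
  exact hx (by simp [gradient, h])

theorem exists_pair {φ : RSpace n → ℝ} (h1 : ContDiff ℝ ∞ φ) (h2 : HasCompactSupport φ) :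
    ∃ p : L2Pair n, p.fst =ᵐ[volume] φ ∧ p.snd =ᵐ[volume] gradient φ := by
  have m1 : MemLp φ 2 (volume : Measure (RSpace n)) :=
    h1.continuous.memLp_of_hasCompactSupport h2
  have m2 : MemLp (gradient φ) 2 (volume : Measure (RSpace n)) :=
    (continuous_gradient h1).memLp_of_hasCompactSupport
      (h2.mono' (subset_closure.trans (tsupport_gradient_subset φ)))
  exact ⟨WithLp.toLp 2 (m1.toLp φ, m2.toLp _), m1.coeFn_toLp, m2.coeFn_toLp⟩

theorem norm_gradient (φ : RSpace n → ℝ) (x : RSpace n) : ‖gradient φ x‖ = ‖fderiv ℝ φ x‖ := by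
  rw [gradient, LinearIsometryEquiv.norm_map]

/-! ### The space `H¹₀` -/

theorem isClosed_H10 (U : Set (RSpace n)) : IsClosed (H10 U : Set (L2Pair n)) :=
  Submodule.isClosed_topologicalClosure _

instance (U : Set (RSpace n)) : CompleteSpace (H10 U) :=
  (isClosed_H10 U).completeSpace_coe

theorem H10_mono {U V : Set (RSpace n)} (h : U ⊆ V) : H10 U ≤ H10 V := by
  refine Submodule.topologicalClosure_mono ?_
  rintro p ⟨φ, h1, h2, h3, h4, h5⟩
  exact ⟨φ, h1, h2, h3.trans h, h4, h5⟩

/-- A closed condition on `H¹₀(U)` may be checked on smooth functions. -/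
theorem H10_induction {U : Set (RSpace n)} {P : L2Pair n → Prop} (hP : IsClosed {p | P p})
    (h : ∀ p ∈ testPairs U, P p) {p : L2Pair n} (hp : p ∈ H10 U) : P p :=
  closure_minimal (s := (testPairs U : Set (L2Pair n))) (t := {p | P p}) h hP hp

theorem snd_eq_zero_of_notMem {U : Set (RSpace n)} {p : L2Pair n} (hp : p ∈ H10 U) :
    ∀ᵐ x ∂volume.restrict Uᶜ, p.snd x = 0 := by
  let T : L2Pair n →L[ℝ] Lp (RSpace n) 2 ((volume : Measure (RSpace n)).restrict Uᶜ) :=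
    (LpToLpRestrictCLM (RSpace n) (RSpace n) ℝ volume 2 Uᶜ).comp (WithLp.sndL 2 ℝ _ _)
  have e : ∀ p : L2Pair n, T p =ᵐ[volume.restrict Uᶜ] p.snd := fun p =>
    LpToLpRestrictCLM_coeFn ℝ Uᶜ p.snd
  have key : T p = 0 := by
    refine H10_induction (P := fun p => T p = 0) (isClosed_eq T.continuous continuous_const) ?_ hp
    rintro p ⟨φ, -, -, h3, -, h5⟩
    rw [Lp.eq_zero_iff_ae_eq_zero]
    have hm : ∀ᵐ x ∂(volume : Measure (RSpace n)).restrict Uᶜ, x ∉ tsupport φ := by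
      rw [ae_iff]
      simp only [not_not]
      have hms : MeasurableSet (tsupport φ) := (isClosed_tsupport φ).measurableSet
      change (volume.restrict Uᶜ) (tsupport φ) = 0
      rw [Measure.restrict_apply hms,
        Set.disjoint_iff_inter_eq_empty.1 (Set.disjoint_compl_right_iff_subset.2 h3)]
      exact measure_empty
    filter_upwards [e p, ae_restrict_of_ae h5, hm] with x hx h1 h2
    rw [hx, h1]
    exact image_eq_zero_of_notMem_tsupport fun h => h2 (tsupport_gradient_subset φ h)
  have := (Lp.eq_zero_iff_ae_eq_zero).1 key
  filter_upwards [e p, this] with x h1 h2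
  rw [← h1, h2]
  rfl

theorem snd_eq_zero_of_notMem' {U : Set (RSpace n)} (hU : MeasurableSet U) {p : L2Pair n}
    (hp : p ∈ H10 U) : ∀ᵐ x ∂volume, x ∉ U → p.snd x = 0 :=
  (ae_restrict_iff' hU.compl).1 (snd_eq_zero_of_notMem hp)

/-- The weak gradient of an element of `H¹₀` is determined by the function. -/
theorem eq_zero_of_fst_eq_zero {U : Set (RSpace n)} {p : L2Pair n} (hp : p ∈ H10 U)
    (h0 : p.fst = 0) : p = 0 := by
  -- Integration by parts against a fixed `η`, with `q` standing for `∂ᵢη` and `r` for `η eᵢ`.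
  -- Written with inner products it is a closed condition, so it passes from test functions to
  -- `H¹₀`.
  have key : ∀ (η : RSpace n → ℝ) (h1 : ContDiff ℝ ∞ η) (h2 : HasCompactSupport η),
      ∀ p ∈ H10 U, ∀ i : Fin n, ∃ q : Lp ℝ 2 (volume : Measure (RSpace n)),
      ∃ r : Lp (RSpace n) 2 (volume : Measure (RSpace n)),
      (r =ᵐ[volume] fun x => η x • EuclideanSpace.single i (1 : ℝ)) ∧
      inner ℝ p.snd r = - inner ℝ p.fst q := by
    intro η h1 h2 p hp i
    have m1 : MemLp (fun x => fderiv ℝ η x (EuclideanSpace.single i 1)) 2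
        (volume : Measure (RSpace n)) :=
      (contDiff_fderiv_apply h1 _).continuous.memLp_of_hasCompactSupport (h2.fderiv_apply ℝ _)
    have m2 : MemLp (fun x => η x • EuclideanSpace.single i (1 : ℝ)) 2
        (volume : Measure (RSpace n)) :=
      (h1.continuous.smul continuous_const).memLp_of_hasCompactSupport h2.smul_right
    refine ⟨m1.toLp _, m2.toLp _, m2.coeFn_toLp, ?_⟩
    refine H10_induction (P := fun p : L2Pair n => inner ℝ p.snd (m2.toLp _)
      = - inner ℝ p.fst (m1.toLp _)) ?_ ?_ hp
    · refine isClosed_eq ?_ ?_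
      · exact ((WithLp.sndL 2 ℝ _ _).continuous.inner continuous_const)
      · exact ((WithLp.fstL 2 ℝ _ _).continuous.inner continuous_const).neg
    · rintro p ⟨φ, k1, k2, -, k4, k5⟩
      rw [L2.inner_def, L2.inner_def]
      have e := integral_fderiv_mul k1 k2 h1 (EuclideanSpace.single i 1)
      have e1 : ∫ x, inner ℝ (p.snd x) (m2.toLp _ x)
          = ∫ x, fderiv ℝ φ x (EuclideanSpace.single i 1) * η x := by
        refine integral_congr_ae ?_
        filter_upwards [k5, m2.coeFn_toLp] with x h h'
        rw [h, h', inner_smul_right, EuclideanSpace.inner_single_right, gradient_apply]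
        simp [mul_comm]
      have e2 : ∫ x, inner ℝ (p.fst x) (m1.toLp _ x)
          = ∫ x, φ x * fderiv ℝ η x (EuclideanSpace.single i 1) := by
        refine integral_congr_ae ?_
        filter_upwards [k4, m1.coeFn_toLp] with x h h'
        rw [h, h']
        simp [mul_comm]
      rw [e1, e2, e, neg_neg]
  have hs : p.snd = 0 := by
    rw [Lp.eq_zero_iff_ae_eq_zero]
    have hi : ∀ i : Fin n, ∀ᵐ x ∂(volume : Measure (RSpace n)), p.snd x i = 0 := by
      intro i
      have hm : MemLp (fun x => p.snd x i) 2 (volume : Measure (RSpace n)) :=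
        (EuclideanSpace.proj (𝕜 := ℝ) i).comp_memLp' (Lp.memLp p.snd)
      refine ae_eq_zero_of_integral_contDiff_smul_eq_zero
        (hm.locallyIntegrable (by norm_num)) ?_
      intro η h1 h2
      obtain ⟨q, r, hr, he⟩ := key η h1 h2 p hp i
      rw [h0, inner_zero_left, neg_zero, L2.inner_def] at he
      rw [← he]
      refine integral_congr_ae ?_
      filter_upwards [hr] with x h
      rw [h, inner_smul_right, EuclideanSpace.inner_single_right]
      simp
    filter_upwards [ae_all_iff.2 hi] with x hx
    ext i
    exact hx i
  exact (WithLp.ofLp_injective 2) (Prod.ext h0 hs)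

theorem H10_ext {Ω : Set (RSpace n)} {u v : H10 Ω}
    (h : (u : L2Pair n).fst = (v : L2Pair n).fst) : u = v := by
  have := eq_zero_of_fst_eq_zero (u - v).2 (by simp [h])
  rw [← sub_eq_zero]
  exact Subtype.ext this

/-- Poincaré's inequality in a bounded set. -/
theorem exists_norm_fst_le (hn : 0 < n) {Ω : Set (RSpace n)} (hΩ : Bornology.IsBounded Ω) :
    ∃ C : ℝ, 0 ≤ C ∧ ∀ p ∈ H10 Ω, ‖p.fst‖ ≤ C * ‖p.snd‖ := by
  obtain ⟨R, hR0, hR⟩ := hΩ.exists_pos_norm_le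
  refine ⟨2 * R, by positivity, fun p hp => ?_⟩
  refine H10_induction (P := fun p : L2Pair n => ‖p.fst‖ ≤ 2 * R * ‖p.snd‖) ?_ ?_ hp
  · exact isClosed_le (WithLp.fstL 2 ℝ _ _).continuous.norm
      (continuous_const.mul (WithLp.sndL 2 ℝ _ _).continuous.norm)
  rintro p ⟨φ, h1, h2, h3, h4, h5⟩
  let i : Fin n := ⟨0, hn⟩
  have hx : ContDiff ℝ ∞ (fun x : RSpace n => x i) := (EuclideanSpace.proj (𝕜 := ℝ) i).contDiff
  have hfx : ∀ x : RSpace n, fderiv ℝ (fun x : RSpace n => x i) x (EuclideanSpace.single i 1) = 1 := by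
    intro x
    have : fderiv ℝ (fun x : RSpace n => x i) x = EuclideanSpace.proj (𝕜 := ℝ) i :=
      (EuclideanSpace.proj (𝕜 := ℝ) i).fderiv
    rw [this]
    simp
  -- Since `∂ᵢxᵢ = 1`, `∫ φ² = -∫ 2 xᵢ φ ∂ᵢφ`, and `|xᵢ| ≤ R` on the support; this gives the
  -- constant `2R`.
  have e := integral_fderiv_mul (h1.mul h1) h2.mul_right hx (EuclideanSpace.single i 1)
  simp only [hfx, mul_one] at e
  have hn1 : ‖p.fst‖ ^ 2 = ∫ x, φ x * φ x := by
    rw [← real_inner_self_eq_norm_sq, L2.inner_def]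
    refine integral_congr_ae ?_
    filter_upwards [h4] with x hx
    simp [hx, sq]
  obtain ⟨F, F_def⟩ : ∃ F : RSpace n → ℝ, F = fun x => -(2 * x i * φ x) := ⟨_, rfl⟩
  have cF : Continuous F := by
    rw [F_def]
    exact ((continuous_const.mul hx.continuous).mul h1.continuous).neg
  have sF : HasCompactSupport F := by
    refine h2.mono fun x hx h => hx ?_
    simp [F_def, h]
  have mF : MemLp (fun x => (F x) • EuclideanSpace.single i (1 : ℝ)) 2
      (volume : Measure (RSpace n)) :=
    (cF.smul continuous_const).memLp_of_hasCompactSupport sF.smul_right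
  have hn2 : ‖p.fst‖ ^ 2 = inner ℝ (mF.toLp _) p.snd := by
    rw [hn1, e, L2.inner_def, ← integral_neg]
    refine integral_congr_ae ?_
    filter_upwards [h5, mF.coeFn_toLp] with x k1 k2
    have hd := (h1.differentiable (by simp)).differentiableAt (x := x)
    rw [k1, k2, real_inner_smul_left, EuclideanSpace.inner_single_left, gradient_apply,
      fderiv_fun_mul hd hd]
    simp only [F_def, add_apply, smul_apply, smul_eq_mul,
      conj_trivial, one_mul]
    ring
  have hF : ‖mF.toLp _‖ ≤ 2 * R * ‖p.fst‖ := by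
    refine Lp.norm_le_mul_norm_of_ae_le_mul ?_
    filter_upwards [h4, mF.coeFn_toLp] with x k1 k2
    rw [k1, k2, norm_smul]
    by_cases hxs : x ∈ tsupport φ
    · have hb : ‖x i‖ ≤ R := (PiLp.norm_apply_le x i).trans (hR x (h3 hxs))
      simp only [F_def, norm_neg, norm_mul, PiLp.norm_single, norm_one, mul_one]
      gcongr
      simp
    · have : φ x = 0 := image_eq_zero_of_notMem_tsupport hxs
      simp [F_def, this]
  rcases eq_or_lt_of_le (norm_nonneg p.fst) with h | h
  · rw [← h]; positivity
  · have := real_inner_le_norm (mF.toLp _) p.snd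
    have h7 : ‖p.fst‖ * ‖p.fst‖ ≤ ‖p.fst‖ * (2 * R * ‖p.snd‖) := by
      calc ‖p.fst‖ * ‖p.fst‖ = ‖p.fst‖ ^ 2 := by ring
        _ ≤ ‖mF.toLp _‖ * ‖p.snd‖ := hn2 ▸ this
        _ ≤ (2 * R * ‖p.fst‖) * ‖p.snd‖ := by gcongr
        _ = _ := by ring
    exact le_of_mul_le_mul_left h7 h

/-! ### Weak compactness -/

/-- If a bounded sequence has a convergent image under a bounded operator between Hilbert spaces,
then the limit is the image of an element with the same bound. -/
theorem exists_eq_of_tendsto {H K : Type*} [NormedAddCommGroup H] [InnerProductSpace ℝ H]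
    [CompleteSpace H] [NormedAddCommGroup K] [InnerProductSpace ℝ K] [CompleteSpace K]
    (T : H →L[ℝ] K) {x : ℕ → H} {C : ℝ} (hx : ∀ j, ‖x j‖ ≤ C) {y : K}
    (hy : Tendsto (fun j => T (x j)) atTop (𝓝 y)) : ∃ z, T z = y ∧ ‖z‖ ≤ C := by
  -- Banach–Alaoglu along an ultrafilter finer than `atTop`, which spares the extraction of a
  -- subsequence. The adjoint of `T` then identifies the image of the weak limit.
  have hc := WeakDual.isCompact_closedBall (𝕜 := ℝ) (E := H) 0 C
  rw [isCompact_iff_ultrafilter_le_nhds] at hc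
  let F : ℕ → WeakDual ℝ H := fun j => StrongDual.toWeakDual (innerSL ℝ (x j))
  obtain ⟨ℓ, hℓ, hlim⟩ := hc ((hyperfilter ℕ).map F) (by
    rw [le_principal_iff]
    change F ⁻¹' _ ∈ (hyperfilter ℕ : Filter ℕ)
    refine Filter.univ_mem' fun j => ?_
    simpa [F] using hx j)
  have hle : (hyperfilter ℕ : Filter ℕ) ≤ atTop := Nat.hyperfilter_le_atTop
  let z : H := (InnerProductSpace.toDual ℝ H).symm (WeakDual.toStrongDual ℓ)
  have hz : ∀ h, inner ℝ z h = ℓ h := fun h => by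
    rw [InnerProductSpace.toDual_symm_apply]
    rfl
  have hev : ∀ h : H, Tendsto (fun j => inner ℝ (x j) h) (hyperfilter ℕ : Filter ℕ)
      (𝓝 (inner ℝ z h)) := by
    intro h
    rw [hz]
    exact ((WeakDual.eval_continuous h).tendsto ℓ).comp (tendsto_iff_comap.2 (by
      exact tendsto_iff_comap.1 hlim))
  refine ⟨z, ?_, ?_⟩
  · refine ext_inner_right ℝ fun k => ?_
    have h1 := hev (ContinuousLinearMap.adjoint T k)
    simp only [ContinuousLinearMap.adjoint_inner_right] at h1
    exact tendsto_nhds_unique h1 ((hy.mono_left hle).inner tendsto_const_nhds)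
  · simpa [z] using hℓ

/-! ### The bilinear form of an operator with constant coefficients -/

/-- The action of a matrix on square integrable vector fields. -/
def matOp (a : Matrix (Fin n) (Fin n) ℝ) :
    Lp (RSpace n) 2 (volume : Measure (RSpace n)) →L[ℝ]
      Lp (RSpace n) 2 (volume : Measure (RSpace n)) :=
  (Matrix.toEuclideanCLM (𝕜 := ℝ) a).compLpL 2 volume

theorem inner_toEuclideanCLM (a : Matrix (Fin n) (Fin n) ℝ) (ξ η : RSpace n) :
    inner ℝ (Matrix.toEuclideanCLM (𝕜 := ℝ) a ξ) η = ∑ i, ∑ j, a i j * ξ j * η i := by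
  simp only [PiLp.inner_apply, Matrix.ofLp_toEuclideanCLM, Matrix.mulVec, dotProduct,
    RCLike.inner_apply, conj_trivial, Finset.mul_sum]
  exact Finset.sum_congr rfl fun i _ => Finset.sum_congr rfl fun j _ => by ring

theorem inner_matOp (a : Matrix (Fin n) (Fin n) ℝ)
    (F G : Lp (RSpace n) 2 (volume : Measure (RSpace n))) :
    inner ℝ (matOp a F) G = ∑ i, ∑ j, ∫ x, a i j * F x j * G x i := by
  have hm : ∀ (F : Lp (RSpace n) 2 (volume : Measure (RSpace n))) (i : Fin n),
      MemLp (fun x => F x i) 2 (volume : Measure (RSpace n)) := fun F i =>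
    (EuclideanSpace.proj (𝕜 := ℝ) i).comp_memLp' (Lp.memLp F)
  have hint : ∀ i j, Integrable (fun x => a i j * F x j * G x i)
      (volume : Measure (RSpace n)) := fun i j =>
    ((hm F j).const_mul (a i j)).integrable_mul (hm G i)
  rw [L2.inner_def]
  simp_rw [← integral_finsetSum _ fun j _ => hint _ j]
  rw [← integral_finsetSum _ fun i _ => integrable_finsetSum _ fun j _ => hint i j]
  refine integral_congr_ae ?_
  filter_upwards [ContinuousLinearMap.coeFn_compLpL (p := 2) (μ := (volume : Measure (RSpace n)))
    (Matrix.toEuclideanCLM (𝕜 := ℝ) a) F] with x hx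
  rw [matOp, hx, inner_toEuclideanCLM]

/-- The gradient of `u` vanishes almost everywhere outside `U`, so all the energies are one form on
the whole space, whatever the domain of integration. -/
theorem energy_eq (a : Matrix (Fin n) (Fin n) ℝ) {U Ω : Set (RSpace n)} (hU : MeasurableSet U)
    {u : H10 Ω} (hu : (u : L2Pair n) ∈ H10 U) (v : H10 Ω) :
    energy a U u v = inner ℝ (matOp a (u : L2Pair n).snd) (v : L2Pair n).snd := by
  rw [inner_matOp, energy]
  refine Finset.sum_congr rfl fun i _ => Finset.sum_congr rfl fun j _ => ?_
  refine setIntegral_eq_integral_of_ae_compl_eq_zero ?_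
  filter_upwards [snd_eq_zero_of_notMem' hU hu] with x hx hxU
  simp [grad, hx hxU]

theorem le_inner_matOp {a : Matrix (Fin n) (Fin n) ℝ} {γ : ℝ}
    (ha : ∀ ξ : RSpace n, γ * ‖ξ‖ ^ 2 ≤ ∑ i, ∑ j, a i j * ξ i * ξ j)
    (F : Lp (RSpace n) 2 (volume : Measure (RSpace n))) :
    γ * ‖F‖ ^ 2 ≤ inner ℝ (matOp a F) F := by
  rw [← real_inner_self_eq_norm_sq, L2.inner_def, L2.inner_def, ← integral_const_mul]
  refine integral_mono_ae ((L2.integrable_inner F F).const_mul γ) (L2.integrable_inner _ _) ?_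
  filter_upwards [ContinuousLinearMap.coeFn_compLpL (p := 2) (μ := (volume : Measure (RSpace n)))
    (Matrix.toEuclideanCLM (𝕜 := ℝ) a) F] with x hx
  rw [matOp, hx, inner_toEuclideanCLM, real_inner_self_eq_norm_sq]
  refine (ha (F x)).trans (le_of_eq ?_)
  exact Finset.sum_congr rfl fun i _ => Finset.sum_congr rfl fun j _ => by ring

theorem inner_matOp_comm_of_testPairs (a : Matrix (Fin n) (Fin n) ℝ) {U V : Set (RSpace n)}
    {p q : L2Pair n} (hp : p ∈ testPairs U) (hq : q ∈ testPairs V) :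
    inner ℝ (matOp a p.snd) q.snd = inner ℝ (matOp a q.snd) p.snd := by
  obtain ⟨φ, h1, h2, -, -, h5⟩ := hp
  obtain ⟨ψ, k1, k2, -, -, k5⟩ := hq
  have e : ∀ i j, ∫ x, p.snd x j * q.snd x i = ∫ x,
      fderiv ℝ φ x (EuclideanSpace.single j 1) * fderiv ℝ ψ x (EuclideanSpace.single i 1) := by
    intro i j
    refine integral_congr_ae ?_
    filter_upwards [h5, k5] with x e1 e2
    rw [e1, e2, gradient_apply, gradient_apply]
  -- The exchange holds for each pair of indices separately, hence for any constant matrix.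
  have e' : ∀ i j, ∫ x, p.snd x j * q.snd x i = ∫ x, p.snd x i * q.snd x j := fun i j =>
    (e i j).trans ((integral_fderiv_mul_fderiv_comm h1 h2 k1 _ _).trans (e j i).symm)
  rw [inner_matOp, inner_matOp]
  refine Finset.sum_congr rfl fun i _ => Finset.sum_congr rfl fun j _ => ?_
  calc ∫ x, a i j * p.snd x j * q.snd x i = a i j * ∫ x, p.snd x j * q.snd x i := by
        rw [← integral_const_mul]
        exact integral_congr_ae (ae_of_all _ fun x => mul_assoc _ _ _)
    _ = ∫ x, a i j * q.snd x j * p.snd x i := by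
        rw [e', ← integral_const_mul]
        exact integral_congr_ae (ae_of_all _ fun x => by ring)

/-- As the coefficients are constant, the bilinear form is symmetric on `H¹₀`, whether or not the
matrix is. -/
theorem inner_matOp_comm (a : Matrix (Fin n) (Fin n) ℝ) {Ω : Set (RSpace n)} {p q : L2Pair n}
    (hp : p ∈ H10 Ω) (hq : q ∈ H10 Ω) :
    inner ℝ (matOp a p.snd) q.snd = inner ℝ (matOp a q.snd) p.snd := by
  have c1 : Continuous fun p : L2Pair n => p.snd := (WithLp.sndL 2 ℝ _ _).continuous
  have c2 : Continuous fun p : L2Pair n => matOp a p.snd := (matOp a).continuous.comp c1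
  have step : ∀ p ∈ testPairs Ω, inner ℝ (matOp a p.snd) q.snd
      = inner ℝ (matOp a q.snd) p.snd := fun p hp =>
    H10_induction (P := fun q : L2Pair n =>
      inner ℝ (matOp a p.snd) q.snd = inner ℝ (matOp a q.snd) p.snd)
      (isClosed_eq (continuous_const.inner c1) (c2.inner continuous_const))
      (fun q hq => inner_matOp_comm_of_testPairs a hp hq) hq
  exact H10_induction (P := fun p : L2Pair n =>
    inner ℝ (matOp a p.snd) q.snd = inner ℝ (matOp a q.snd) p.snd)
    (isClosed_eq (c2.inner continuous_const) (continuous_const.inner c1)) step hp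

/-! ### Composition with a smooth contraction -/

theorem exists_comp {Ω : Set (RSpace n)} (u : H10 Ω) {g : ℝ → ℝ} (hg : ContDiff ℝ ∞ g)
    (hg0 : g 0 = 0) (hL : LipschitzWith 1 g) :
    ∃ p : H10 Ω, fn p =ᵐ[volume] (fun x => g (fn u x)) ∧ ‖p‖ ≤ ‖u‖ := by
  have hu : (u : L2Pair n) ∈ closure (testPairs Ω : Set (L2Pair n)) := u.2
  obtain ⟨q, hq, hlim⟩ := mem_closure_iff_seq_limit.1 hu
  have key : ∀ j, ∃ r : H10 Ω, (r : L2Pair n).fst = hL.compLp hg0 (q j).fst ∧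
      ‖r‖ ≤ ‖q j‖ := by
    intro j
    obtain ⟨φ, h1, h2, h3, h4, h5⟩ := hq j
    have k1 : ContDiff ℝ ∞ (g ∘ φ) := hg.comp h1
    have k2 : HasCompactSupport (g ∘ φ) := h2.comp_left hg0
    obtain ⟨r, r4, r5⟩ := exists_pair k1 k2
    have k3 : tsupport (g ∘ φ) ⊆ Ω :=
      (closure_mono (Function.support_comp_subset hg0 φ)).trans h3
    refine ⟨⟨r, Submodule.le_topologicalClosure _ ⟨_, k1, k2, k3, r4, r5⟩⟩, ?_, ?_⟩
    · refine Lp.ext ?_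
      filter_upwards [r4, hL.coeFn_compLp hg0 (q j).fst, h4] with x e1 e2 e3
      rw [e1, e2, Function.comp_apply, Function.comp_apply, e3]
    · have n1 : ‖r.fst‖ ≤ ‖(q j).fst‖ := by
        refine Lp.norm_le_norm_of_ae_le ?_
        filter_upwards [r4, h4] with x e1 e3
        rw [e1, e3]
        simpa [hg0] using hL.norm_sub_le (φ x) 0
      have n2 : ‖r.snd‖ ≤ ‖(q j).snd‖ := by
        refine Lp.norm_le_norm_of_ae_le ?_
        filter_upwards [r5, h5] with x e1 e3
        rw [e1, e3, norm_gradient, norm_gradient]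
        rw [fderiv_comp x (hg.differentiable (by simp)).differentiableAt
          (h1.differentiable (by simp)).differentiableAt]
        refine (ContinuousLinearMap.opNorm_comp_le _ _).trans ?_
        have := norm_fderiv_le_of_lipschitz ℝ (x₀ := φ x) hL
        calc _ ≤ 1 * ‖fderiv ℝ φ x‖ := by gcongr; exact_mod_cast this
          _ = _ := one_mul _
      have : ‖r‖ ^ 2 ≤ ‖q j‖ ^ 2 := by
        rw [WithLp.prod_norm_sq_eq_of_L2, WithLp.prod_norm_sq_eq_of_L2]
        gcongr
      exact (sq_le_sq₀ (norm_nonneg _) (norm_nonneg _)).1 this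
  choose r hr1 hr2 using key
  let T : H10 Ω →L[ℝ] Lp ℝ 2 (volume : Measure (RSpace n)) :=
    (WithLp.fstL 2 ℝ _ _).comp (H10 Ω).subtypeL
  have hT : Tendsto (fun j => T (r j)) atTop (𝓝 (hL.compLp hg0 (u : L2Pair n).fst)) := by
    have h1 : Tendsto (fun j => (q j).fst) atTop (𝓝 (u : L2Pair n).fst) :=
      ((WithLp.fstL 2 ℝ _ _).continuous.tendsto _).comp hlim
    have h2 := ((hL.continuous_compLp hg0).tendsto (u : L2Pair n).fst).comp h1
    refine h2.congr fun j => (hr1 j).symm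
  have hnorm : Tendsto (fun j => ‖q j‖) atTop (𝓝 ‖u‖) := hlim.norm
  -- The compositions `g ∘ qⱼ` converge in `L²` only, but with norms eventually at most `‖u‖ + ε`,
  -- so a weak limit has that bound. The limits for different `ε` coincide because their functions
  -- do.
  have main : ∀ ε > 0, ∃ z, T z = hL.compLp hg0 (u : L2Pair n).fst ∧ ‖z‖ ≤ ‖u‖ + ε := by
    intro ε hε
    obtain ⟨N, hN⟩ := eventually_atTop.1
      (hnorm.eventually (ge_mem_nhds (lt_add_of_pos_right ‖u‖ hε)))
    exact exists_eq_of_tendsto T (x := fun j => r (j + N))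
      (fun j => (hr2 _).trans (hN _ (Nat.le_add_left _ _))) (hT.comp (tendsto_add_atTop_nat N))
  obtain ⟨z, hz, -⟩ := main 1 one_pos
  refine ⟨z, ?_, le_of_forall_pos_le_add fun ε hε => ?_⟩
  · filter_upwards [hL.coeFn_compLp hg0 (u : L2Pair n).fst] with x e1
    have : fn z x = (T z : RSpace n → ℝ) x := rfl
    rw [this, hz, e1]
    rfl
  · obtain ⟨z', hz', hb⟩ := main ε hε
    have : z = z' := H10_ext (hz.trans hz'.symm)
    rwa [this]

/-! ### Capacity estimates -/

/-- Poincaré's inequality holds in `Ω`. -/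
def HasPoincare (Ω : Set (RSpace n)) : Prop :=
  ∃ C : ℝ, 0 ≤ C ∧ ∀ p ∈ H10 Ω, ‖p.fst‖ ≤ C * ‖p.snd‖

theorem HasPoincare.exists_norm_le {Ω : Set (RSpace n)} (h : HasPoincare Ω) :
    ∃ K : ℝ, 0 < K ∧ ∀ u : H10 Ω, ‖u‖ ≤ K * ‖(u : L2Pair n).snd‖ := by
  obtain ⟨C, hC, h⟩ := h
  refine ⟨C + 1, by positivity, fun u => ?_⟩
  have h1 := h u u.2
  have h2 : ‖u‖ ^ 2 = ‖(u : L2Pair n).fst‖ ^ 2 + ‖(u : L2Pair n).snd‖ ^ 2 :=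
    WithLp.prod_norm_sq_eq_of_L2 (u : L2Pair n)
  refine (sq_le_sq₀ (norm_nonneg _) (by positivity)).1 ?_
  have h3 : ‖(u : L2Pair n).fst‖ ^ 2 ≤ (C * ‖(u : L2Pair n).snd‖) ^ 2 := by gcongr
  nlinarith [sq_nonneg ‖(u : L2Pair n).snd‖, mul_nonneg hC (sq_nonneg ‖(u : L2Pair n).snd‖)]

theorem lintegral_enorm_sq {α E : Type*} [MeasurableSpace α] {μ : Measure α}
    [NormedAddCommGroup E] (F : Lp E 2 μ) :
    ∫⁻ x, ‖F x‖ₑ ^ 2 ∂μ = ENNReal.ofReal (‖F‖ ^ 2) := by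
  have h : ENNReal.ofReal ‖F‖ = eLpNorm F 2 μ := by
    rw [Lp.norm_def, ENNReal.ofReal_toReal (Lp.eLpNorm_ne_top F)]
  rw [ENNReal.ofReal_pow (norm_nonneg _), h,
    eLpNorm_eq_lintegral_rpow_enorm_toReal (by norm_num) (by norm_num)]
  simp only [ENNReal.toReal_ofNat, ENNReal.rpow_ofNat, one_div]
  rw [← ENNReal.rpow_natCast, ← ENNReal.rpow_mul]
  norm_num

/-- The linear map sending an element of `H¹₀` to its function. -/
def fnL (Ω : Set (RSpace n)) : H10 Ω →L[ℝ] Lp ℝ 2 (volume : Measure (RSpace n)) :=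
  (WithLp.fstL 2 ℝ _ _).comp (H10 Ω).subtypeL

theorem fn_add {Ω : Set (RSpace n)} (u v : H10 Ω) :
    fn (u + v) =ᵐ[volume] fun x => fn u x + fn v x :=
  Lp.coeFn_add (fnL Ω u) (fnL Ω v)

theorem fn_sub {Ω : Set (RSpace n)} (u v : H10 Ω) :
    fn (u - v) =ᵐ[volume] fun x => fn u x - fn v x :=
  Lp.coeFn_sub (fnL Ω u) (fnL Ω v)

theorem fn_smul {Ω : Set (RSpace n)} (c : ℝ) (u : H10 Ω) :
    fn (c • u) =ᵐ[volume] fun x => c * fn u x :=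
  Lp.coeFn_smul c (fnL Ω u)

theorem norm_fnL_le {Ω : Set (RSpace n)} (u : H10 Ω) : ‖fnL Ω u‖ ≤ ‖u‖ := by
  have h2 : ‖u‖ ^ 2 = ‖fnL Ω u‖ ^ 2 + ‖(u : L2Pair n).snd‖ ^ 2 :=
    WithLp.prod_norm_sq_eq_of_L2 (u : L2Pair n)
  refine (sq_le_sq₀ (norm_nonneg _) (norm_nonneg _)).1 ?_
  nlinarith [sq_nonneg ‖(u : L2Pair n).snd‖]

/-- There is a nonnegative element of `H¹₀(Ω)`, of norm at most `r`, which is at least `1` in a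
neighbourhood of `E`. -/
def CapLe (Ω E : Set (RSpace n)) (r : ℝ) : Prop :=
  ∃ (w : H10 Ω) (G : Set (RSpace n)), IsOpen G ∧ E ⊆ G ∧ (∀ᵐ x, 0 ≤ fn w x) ∧
    (∀ᵐ x, x ∈ G → 1 ≤ fn w x) ∧ ‖w‖ ≤ r

/-- The sets of zero capacity. -/
def CapNull (Ω E : Set (RSpace n)) : Prop := ∀ r : ℝ, 0 < r → CapLe Ω E r

theorem CapLe.mono {Ω E E' : Set (RSpace n)} {r r' : ℝ} (h : CapLe Ω E r) (hE : E' ⊆ E)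
    (hr : r ≤ r') : CapLe Ω E' r' := by
  obtain ⟨w, G, h1, h2, h3, h4, h5⟩ := h
  exact ⟨w, G, h1, hE.trans h2, h3, h4, h5.trans hr⟩

theorem CapLe.exists_isOpen {Ω E : Set (RSpace n)} {r : ℝ} (h : CapLe Ω E r) :
    ∃ G, IsOpen G ∧ E ⊆ G ∧ CapLe Ω G r := by
  obtain ⟨w, G, h1, h2, h3, h4, h5⟩ := h
  exact ⟨G, h1, h2, w, G, h1, subset_rfl, h3, h4, h5⟩

/-- The witnesses are nonnegative, so their sum does the work of the maximum and no lattice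
operations on `H¹₀` are needed. -/
theorem CapLe.union {Ω E E' : Set (RSpace n)} {r r' : ℝ} (h : CapLe Ω E r)
    (h' : CapLe Ω E' r') : CapLe Ω (E ∪ E') (r + r') := by
  obtain ⟨w, G, h1, h2, h3, h4, h5⟩ := h
  obtain ⟨w', G', k1, k2, k3, k4, k5⟩ := h'
  refine ⟨w + w', G ∪ G', h1.union k1, Set.union_subset_union h2 k2, ?_, ?_,
    (norm_add_le _ _).trans (add_le_add h5 k5)⟩
  · filter_upwards [h3, k3, fn_add w w'] with x a b c
    rw [c]; positivity
  · filter_upwards [h3, k3, h4, k4, fn_add w w'] with x a b c d e hx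
    rw [e]
    rcases hx with hx | hx
    · linarith [c hx]
    · linarith [d hx]

/-- The series of the witnesses converges in norm, and by nonnegativity its sum dominates each term.
-/
theorem CapLe.iUnion {Ω : Set (RSpace n)} {E : ℕ → Set (RSpace n)} {r : ℕ → ℝ}
    (h : ∀ j, CapLe Ω (E j) (r j)) (hr : Summable r) : CapLe Ω (⋃ j, E j) (∑' j, r j) := by
  choose w G h1 h2 h3 h4 h5 using h
  have hw : Summable w := Summable.of_norm_bounded hr h5
  have hs : HasSum (fun j => fnL Ω (w j)) (fnL Ω (∑' j, w j)) := (fnL Ω).hasSum hw.hasSum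
  have h0 : ∀ j, 0 ≤ fnL Ω (w j) := by
    intro j
    rw [← Lp.coeFn_le]
    filter_upwards [h3 j, Lp.coeFn_zero ℝ 2 (volume : Measure (RSpace n))] with x hx h0
    rw [h0]
    exact hx
  have hle : ∀ j, ∀ᵐ x, fn (w j) x ≤ fn (∑' j, w j) x := fun j =>
    (Lp.coeFn_le _ _).2 (le_hasSum hs j fun i _ => h0 i)
  refine ⟨∑' j, w j, ⋃ j, G j, isOpen_iUnion h1, Set.iUnion_mono h2, ?_, ?_,
    tsum_of_norm_bounded hr.hasSum h5⟩
  · filter_upwards [h3 0, hle 0] with x a b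
    exact a.trans b
  · filter_upwards [ae_all_iff.2 h4, ae_all_iff.2 hle] with x a b hx
    obtain ⟨j, hj⟩ := Set.mem_iUnion.1 hx
    exact (a j hj).trans (b j)

theorem CapLe.iUnion_geometric {Ω : Set (RSpace n)} {E : ℕ → Set (RSpace n)} {c : ℝ}
    (h : ∀ j, CapLe Ω (E j) (c * (1 / 2) ^ j)) (m : ℕ) :
    CapLe Ω (⋃ j, E (j + m)) (2 * c * (1 / 2) ^ m) := by
  have hs : HasSum (fun j : ℕ => c * (1 / 2 : ℝ) ^ (j + m)) (2 * c * (1 / 2) ^ m) := by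
    have := hasSum_geometric_two.mul_left (c * (1 / 2 : ℝ) ^ m)
    have e : (fun j : ℕ => c * (1 / 2 : ℝ) ^ (j + m))
        = fun j : ℕ => c * (1 / 2 : ℝ) ^ m * (1 / 2) ^ j := by
      funext j
      rw [pow_add]
      ring
    rw [e, show 2 * c * (1 / 2 : ℝ) ^ m = c * (1 / 2) ^ m * 2 by ring]
    exact this
  rw [← hs.tsum_eq]
  exact CapLe.iUnion (fun j => h (j + m)) hs.summable

theorem exists_pow_mul_le (c : ℝ) {r : ℝ} (hr : 0 < r) : ∃ m : ℕ, 2 * c * (1 / 2 : ℝ) ^ m ≤ r := by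
  have : Tendsto (fun m : ℕ => 2 * c * (1 / 2 : ℝ) ^ m) atTop (𝓝 (2 * c * 0)) :=
    (tendsto_pow_atTop_nhds_zero_of_lt_one (by norm_num) (by norm_num)).const_mul _
  rw [mul_zero] at this
  exact (this.eventually (ge_mem_nhds hr)).exists

/-- The Borel–Cantelli lemma for capacity: `S` lies in every tail, and the tails have geometrically
small capacity. -/
theorem CapNull.of_geometric {Ω S : Set (RSpace n)} {E : ℕ → Set (RSpace n)} {c : ℝ}
    (h : ∀ j, CapLe Ω (E j) (c * (1 / 2) ^ j)) (hS : ∀ m, S ⊆ ⋃ j, E (j + m)) :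
    CapNull Ω S := by
  intro r hr
  obtain ⟨m, hm⟩ := exists_pow_mul_le c hr
  exact (CapLe.iUnion_geometric h m).mono (hS m) hm

theorem CapNull.mono {Ω E E' : Set (RSpace n)} (h : CapNull Ω E) (hE : E' ⊆ E) :
    CapNull Ω E' := fun r hr => (h r hr).mono hE le_rfl

theorem CapNull.iUnion {Ω : Set (RSpace n)} {E : ℕ → Set (RSpace n)}
    (h : ∀ j, CapNull Ω (E j)) : CapNull Ω (⋃ j, E j) := by
  intro r hr
  have := CapLe.iUnion_geometric (c := r / 2) (fun j => h j _ (by positivity)) 0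
  exact this.mono (by simp) (by simp [mul_div_cancel₀])

/-- Chebyshev's inequality: a small element of `H¹₀` is large only on a small set. -/
theorem exists_one_le {Ω : Set (RSpace n)} (u : H10 Ω) {t : ℝ} (ht : 0 < t) :
    ∃ p : H10 Ω, (∀ᵐ x, 0 ≤ fn p x) ∧ (∀ᵐ x, t ≤ |fn u x| → 1 ≤ fn p x) ∧
      ‖p‖ ≤ 3 * ‖u‖ / t := by
  -- A smooth substitute for `|s|`, vanishing at `0` and with Lipschitz constant `1`. For `|s| ≥ t`
  -- it is at least `(√2 - 1)t ≥ t/3`, which is where the factor `3` comes from.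
  let g : ℝ → ℝ := fun s => √(s ^ 2 + t ^ 2) - t
  have hpos : ∀ s : ℝ, 0 < s ^ 2 + t ^ 2 := fun s => by positivity
  have hg : ContDiff ℝ ∞ g := by
    refine ContDiff.sub (ContDiff.sqrt (by fun_prop) fun s => (hpos s).ne') contDiff_const
  have hg0 : g 0 = 0 := by simp [g, Real.sqrt_sq ht.le]
  have hL : LipschitzWith 1 g := by
    refine LipschitzWith.of_dist_le_mul fun s s' => ?_
    rw [Real.dist_eq, Real.dist_eq, NNReal.coe_one, one_mul]
    have e : g s - g s' = √(s ^ 2 + t ^ 2) - √(s' ^ 2 + t ^ 2) := by simp [g]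
    rw [e]
    have p1 := Real.sqrt_pos.2 (hpos s)
    have p2 := Real.sqrt_pos.2 (hpos s')
    have q1 := Real.sq_sqrt (hpos s).le
    have q2 := Real.sq_sqrt (hpos s').le
    have hA : |s| ≤ √(s ^ 2 + t ^ 2) := Real.abs_le_sqrt (by nlinarith)
    have hB : |s'| ≤ √(s' ^ 2 + t ^ 2) := Real.abs_le_sqrt (by nlinarith)
    have hAB : |s + s'| ≤ √(s ^ 2 + t ^ 2) + √(s' ^ 2 + t ^ 2) :=
      (abs_add_le _ _).trans (add_le_add hA hB)
    have hf : (√(s ^ 2 + t ^ 2) - √(s' ^ 2 + t ^ 2)) * (√(s ^ 2 + t ^ 2) + √(s' ^ 2 + t ^ 2))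
        = (s - s') * (s + s') := by
      nlinarith
    have := congrArg abs hf
    rw [abs_mul, abs_mul, abs_of_pos (add_pos p1 p2)] at this
    refine le_of_mul_le_mul_right ?_ (add_pos p1 p2)
    rw [this]
    gcongr
  have hgn : ∀ s, 0 ≤ g s := fun s => by
    have : t ≤ √(s ^ 2 + t ^ 2) := Real.le_sqrt_of_sq_le (by nlinarith [sq_nonneg s])
    simpa [g] using this
  have hg1 : ∀ s, t ≤ |s| → t / 3 ≤ g s := fun s hs => by
    have h1 : t ^ 2 ≤ s ^ 2 := by
      rw [← sq_abs s]; gcongr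
    have : 4 * t / 3 ≤ √(s ^ 2 + t ^ 2) := Real.le_sqrt_of_sq_le (by nlinarith [sq_nonneg t])
    simp only [g]
    linarith
  obtain ⟨p, hp, hpn⟩ := exists_comp u hg hg0 hL
  refine ⟨(3 / t) • p, ?_, ?_, ?_⟩
  · filter_upwards [hp, fn_smul (3 / t) p] with x h1 h2
    rw [h2, h1]
    have := hgn (fn u x)
    positivity
  · filter_upwards [hp, fn_smul (3 / t) p] with x h1 h2 hx
    rw [h2, h1]
    have := hg1 _ hx
    calc (1 : ℝ) = 3 / t * (t / 3) := by field_simp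
      _ ≤ _ := by gcongr
  · rw [norm_smul, Real.norm_of_nonneg (by positivity)]
    calc 3 / t * ‖p‖ ≤ 3 / t * ‖u‖ := by gcongr
      _ = _ := by ring

theorem capLe_of_one_le {Ω E G : Set (RSpace n)} (u : H10 Ω) {t : ℝ} (ht : 0 < t) (hG : IsOpen G)
    (hE : E ⊆ G) (h : ∀ᵐ x, x ∈ G → t ≤ |fn u x|) : CapLe Ω E (3 * ‖u‖ / t) := by
  obtain ⟨p, h1, h2, h3⟩ := exists_one_le u ht
  refine ⟨p, G, hG, hE, h1, ?_, h3⟩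
  filter_upwards [h, h2] with x a b hx
  exact b (a hx)

/-- A competitor for `cap` has no sign, and only its gradient is controlled. Chebyshev's inequality
at level `1` makes it nonnegative, and Poincaré's inequality bounds its full norm. -/
theorem HasPoincare.capLe_of_cap_lt {Ω : Set (RSpace n)} (hΩ : MeasurableSet Ω)
    (h : HasPoincare Ω) : ∃ K : ℝ, 0 < K ∧ ∀ (E : Set (RSpace n)) (r : ℝ), 0 < r →
      cap Ω E < ENNReal.ofReal (r ^ 2) → CapLe Ω E (K * r) := by
  obtain ⟨K, hK, h⟩ := h.exists_norm_le
  refine ⟨3 * K, by positivity, fun E r hr hE => ?_⟩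
  obtain ⟨w, hw⟩ := iInf_lt_iff.1 hE
  obtain ⟨⟨G, hG, hEG, hw1⟩, hw2⟩ := iInf_lt_iff.1 hw
  have e : ∫⁻ x in Ω, ‖grad w x‖ₑ ^ 2 = ENNReal.ofReal (‖(w : L2Pair n).snd‖ ^ 2) := by
    rw [← lintegral_enorm_sq, ← lintegral_indicator hΩ]
    refine lintegral_congr_ae ?_
    filter_upwards [snd_eq_zero_of_notMem' hΩ w.2] with x hx
    by_cases hxΩ : x ∈ Ω
    · simp [hxΩ, grad]
    · simp [hxΩ, hx hxΩ]
  rw [e, ENNReal.ofReal_lt_ofReal_iff (by positivity)] at hw2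
  have hlt := lt_of_pow_lt_pow_left₀ 2 hr.le hw2
  have := capLe_of_one_le w one_pos hG hEG (by
    filter_upwards [(ae_restrict_iff' hG.measurableSet).1 hw1] with x hx hxG
    exact (hx hxG).trans (le_abs_self _))
  refine this.mono subset_rfl ?_
  have := h w
  nlinarith

theorem CapLe.cap_le {Ω E : Set (RSpace n)} {r : ℝ} (h : CapLe Ω E r) :
    cap Ω E ≤ ENNReal.ofReal (r ^ 2) := by
  obtain ⟨w, G, h1, h2, h3, h4, h5⟩ := h
  refine (iInf₂_le w ⟨G, h1, h2, (ae_restrict_iff' h1.measurableSet).2 h4⟩).trans ?_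
  refine (setLIntegral_le_lintegral _ _).trans ?_
  refine (lintegral_enorm_sq (w : L2Pair n).snd).le.trans (ENNReal.ofReal_le_ofReal ?_)
  have h6 : ‖w‖ ^ 2 = ‖(w : L2Pair n).fst‖ ^ 2 + ‖(w : L2Pair n).snd‖ ^ 2 :=
    WithLp.prod_norm_sq_eq_of_L2 (w : L2Pair n)
  have h7 : ‖w‖ ^ 2 ≤ r ^ 2 := by gcongr
  nlinarith [sq_nonneg ‖(w : L2Pair n).fst‖]

theorem CapNull.cap_eq_zero {Ω E : Set (RSpace n)} (h : CapNull Ω E) : cap Ω E = 0 := by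
  have hlim : Tendsto (fun r : ℝ => ENNReal.ofReal (r ^ 2)) (𝓝[>] 0) (𝓝 0) := by
    have : Continuous fun r : ℝ => ENNReal.ofReal (r ^ 2) :=
      ENNReal.continuous_ofReal.comp (continuous_pow 2)
    simpa using (this.tendsto 0).mono_left nhdsWithin_le_nhds
  refine le_antisymm (ge_of_tendsto hlim ?_) bot_le
  filter_upwards [self_mem_nhdsWithin] with r hr
  exact (h r hr).cap_le

/-- Measures in `M₀(Ω)` vanish on all sets of zero capacity, Borel or not. -/
theorem CapNull.measure_eq_zero {Ω E : Set (RSpace n)} (hΩ : IsOpen Ω) (h : CapNull Ω E)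
    (hE : E ⊆ Ω) {μ : Measure (RSpace n)} (hμ : IsM0 Ω μ) : μ E = 0 := by
  -- The set `E` need not be Borel, so it is enclosed in a Borel set of zero capacity, an
  -- intersection of open sets.
  choose G hG hEG hGc using fun j : ℕ => (h (1 / (j + 1)) (by positivity)).exists_isOpen
  have hn : CapNull Ω (⋂ j, G j ∩ Ω) := by
    intro r hr
    obtain ⟨j, hj⟩ := exists_nat_one_div_lt hr
    exact (hGc j).mono ((Set.iInter_subset _ j).trans Set.inter_subset_left) hj.le
  refine measure_mono_null (Set.subset_iInter fun j => Set.subset_inter (hEG j) hE) (hμ _ ?_ ?_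
    hn.cap_eq_zero)
  · exact (Set.iInter_subset _ 0).trans Set.inter_subset_right
  · exact MeasurableSet.iInter fun j => ((hG j).inter hΩ).measurableSet

theorem CapLe.volume_le {Ω E : Set (RSpace n)} {r : ℝ} (h : CapLe Ω E r) :
    volume E ≤ ENNReal.ofReal (r ^ 2) := by
  obtain ⟨w, G, h1, h2, h3, h4, h5⟩ := h
  calc volume E ≤ volume G := measure_mono h2
    _ = ∫⁻ x in G, 1 := by simp
    _ ≤ ∫⁻ x in G, ‖fnL Ω w x‖ₑ ^ 2 := by
        refine lintegral_mono_ae ((ae_restrict_iff' h1.measurableSet).2 ?_)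
        filter_upwards [h4] with x hx hxG
        have h6 : 1 ≤ fnL Ω w x := hx hxG
        have : (1 : ℝ≥0∞) ≤ ‖fnL Ω w x‖ₑ := by
          rw [Real.enorm_eq_ofReal (by linarith)]
          simpa using h6
        exact one_le_pow₀ this
    _ ≤ ∫⁻ x, ‖fnL Ω w x‖ₑ ^ 2 := setLIntegral_le_lintegral _ _
    _ = ENNReal.ofReal (‖fnL Ω w‖ ^ 2) := lintegral_enorm_sq _
    _ ≤ ENNReal.ofReal (r ^ 2) := by
        refine ENNReal.ofReal_le_ofReal ?_
        have := (norm_fnL_le w).trans h5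
        gcongr

theorem CapNull.volume_eq_zero {Ω E : Set (RSpace n)} (h : CapNull Ω E) : volume E = 0 := by
  have hlim : Tendsto (fun r : ℝ => ENNReal.ofReal (r ^ 2)) (𝓝[>] 0) (𝓝 0) := by
    have : Continuous fun r : ℝ => ENNReal.ofReal (r ^ 2) :=
      ENNReal.continuous_ofReal.comp (continuous_pow 2)
    simpa using (this.tendsto 0).mono_left nhdsWithin_le_nhds
  refine le_antisymm (ge_of_tendsto hlim ?_) bot_le
  filter_upwards [self_mem_nhdsWithin] with r hr
  exact (h r hr).volume_le

/-! ### Quasi-continuous representatives -/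

theorem QuasiContinuousOn.exists_capLe {Ω : Set (RSpace n)} (hΩ : MeasurableSet Ω)
    (hP : HasPoincare Ω) {ψ : RSpace n → ℝ} (h : QuasiContinuousOn Ω ψ) {r : ℝ} (hr : 0 < r) :
    ∃ G, IsOpen G ∧ CapLe Ω G r ∧ ContinuousOn ψ (Ω \ G) := by
  obtain ⟨K, hK, hc⟩ := hP.capLe_of_cap_lt hΩ
  obtain ⟨G, h1, -, h3, h4⟩ := h (ENNReal.ofReal ((r / K) ^ 2))
    (ENNReal.ofReal_pos.2 (by positivity))
  exact ⟨G, h1, (hc G (r / K) (by positivity) h3).mono subset_rfl (by field_simp; rfl), h4⟩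

theorem quasiContinuousOn_of_capLe {Ω : Set (RSpace n)} (hΩ : IsOpen Ω) {ψ : RSpace n → ℝ}
    (h : ∀ r : ℝ, 0 < r → ∃ G, IsOpen G ∧ CapLe Ω G r ∧ ContinuousOn ψ (Ω \ G)) :
    QuasiContinuousOn Ω ψ := by
  intro ε hε
  obtain ⟨r, hr, hrε⟩ : ∃ r : ℝ, 0 < r ∧ ENNReal.ofReal (r ^ 2) < ε := by
    have hlim : Tendsto (fun r : ℝ => ENNReal.ofReal (r ^ 2)) (𝓝[>] 0) (𝓝 0) := by
      have : Continuous fun r : ℝ => ENNReal.ofReal (r ^ 2) :=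
        ENNReal.continuous_ofReal.comp (continuous_pow 2)
      simpa using (this.tendsto 0).mono_left nhdsWithin_le_nhds
    exact ((eventually_mem_nhdsWithin (a := (0 : ℝ)) (s := Set.Ioi 0)).and
      (hlim.eventually (gt_mem_nhds hε))).exists
  obtain ⟨G, h1, h2, h3⟩ := h r hr
  refine ⟨G ∩ Ω, h1.inter hΩ, Set.inter_subset_right,
    (h2.mono Set.inter_subset_left le_rfl).cap_le.trans_lt hrε, ?_⟩
  rwa [Set.sdiff_inter_self_eq_sdiff]

theorem QuasiContinuousOn.add_const_mul {Ω : Set (RSpace n)} (hΩ : IsOpen Ω)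
    (hP : HasPoincare Ω) {ψ χ : RSpace n → ℝ} (h : QuasiContinuousOn Ω ψ)
    (k : QuasiContinuousOn Ω χ) (c : ℝ) : QuasiContinuousOn Ω (fun x => ψ x + c * χ x) := by
  refine quasiContinuousOn_of_capLe hΩ fun r hr => ?_
  obtain ⟨G, h1, h2, h3⟩ := h.exists_capLe hΩ.measurableSet hP (half_pos hr)
  obtain ⟨G', k1, k2, k3⟩ := k.exists_capLe hΩ.measurableSet hP (half_pos hr)
  refine ⟨G ∪ G', h1.union k1, (h2.union k2).mono subset_rfl (add_halves r).le, ?_⟩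
  refine ContinuousOn.add ?_ (continuousOn_const.mul ?_)
  · exact h3.mono (Set.sdiff_subset_sdiff_right Set.subset_union_left)
  · exact k3.mono (Set.sdiff_subset_sdiff_right Set.subset_union_right)

/-- Chebyshev's inequality for quasi-continuous representatives. -/
theorem IsQuasiContRep.capLe {Ω : Set (RSpace n)} (hΩ : IsOpen Ω) (hP : HasPoincare Ω)
    {u : H10 Ω} {ψ : RSpace n → ℝ} (h : IsQuasiContRep u ψ) {t r : ℝ} (ht : 0 < t) (hr : 0 < r) :
    CapLe Ω {x | x ∈ Ω ∧ t < |ψ x|} (3 * ‖u‖ / t + r) := by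
  obtain ⟨G, h1, ⟨w, G', k1, k2, k3, k4, k5⟩, h3⟩ := h.1.exists_capLe hΩ.measurableSet hP hr
  -- Off `G` the set `{|ψ| > t}` is relatively open, so adding `G` yields an open neighbourhood.
  -- There `p` takes care of the points off `G`, where `ψ = fn u` almost everywhere, and `w` of `G`,
  -- at the price `r`.
  obtain ⟨O, hO, hO'⟩ := continuousOn_iff'.1 h3.abs (Set.Ioi t) isOpen_Ioi
  obtain ⟨p, p1, p2, p3⟩ := exists_one_le u ht
  refine ⟨p + w, (O ∩ Ω) ∪ G, (hO.inter hΩ).union h1, ?_, ?_, ?_,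
    (norm_add_le _ _).trans (add_le_add p3 k5)⟩
  · rintro x ⟨hx, hxt⟩
    by_cases hxG : x ∈ G
    · exact Or.inr hxG
    · have : x ∈ (fun x => |ψ x|) ⁻¹' Set.Ioi t ∩ (Ω \ G) := ⟨hxt, hx, hxG⟩
      rw [hO'] at this
      exact Or.inl ⟨this.1, hx⟩
  · filter_upwards [p1, k3, fn_add p w] with x a b e
    rw [e]; positivity
  · filter_upwards [p1, k3, p2, k4, fn_add p w, (ae_restrict_iff' hΩ.measurableSet).1 h.2]
      with x a b c d e f hx
    rw [e]
    by_cases hxG : x ∈ G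
    · linarith [d (k2 hxG)]
    · obtain ⟨hxO, hxΩ⟩ := hx.resolve_right hxG
      have : x ∈ O ∩ (Ω \ G) := ⟨hxO, hxΩ, hxG⟩
      rw [← hO'] at this
      have h5 : t < |ψ x| := this.1
      rw [f hxΩ] at h5
      linarith [c h5.le]

theorem IsQuasiContRep.add_const_mul {Ω : Set (RSpace n)} (hΩ : IsOpen Ω) (hP : HasPoincare Ω)
    {u v : H10 Ω} {ψ χ : RSpace n → ℝ} (h : IsQuasiContRep u ψ) (k : IsQuasiContRep v χ) (c : ℝ) :
    IsQuasiContRep (u + c • v) (fun x => ψ x + c * χ x) := by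
  refine ⟨h.1.add_const_mul hΩ hP k.1 c, ?_⟩
  filter_upwards [h.2, k.2, ae_restrict_of_ae (fn_add u (c • v)),
    ae_restrict_of_ae (fn_smul c v)] with x a b d e
  rw [a, b, d, e]

/-- The difference represents `0`, so Chebyshev's inequality bounds the capacity of each of its
superlevel sets by an arbitrary `r > 0`. -/
theorem IsQuasiContRep.capNull_ne {Ω : Set (RSpace n)} (hΩ : IsOpen Ω) (hP : HasPoincare Ω)
    {u : H10 Ω} {ψ χ : RSpace n → ℝ} (h : IsQuasiContRep u ψ) (k : IsQuasiContRep u χ) :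
    CapNull Ω {x | x ∈ Ω ∧ ψ x ≠ χ x} := by
  have h0 := h.add_const_mul hΩ hP k (-1)
  have : CapNull Ω (⋃ j : ℕ, {x | x ∈ Ω ∧ 1 / ((j : ℝ) + 1) < |ψ x + -1 * χ x|}) := by
    refine CapNull.iUnion fun j r hr => ?_
    refine (h0.capLe hΩ hP (t := 1 / ((j : ℝ) + 1)) (by positivity) hr).mono subset_rfl ?_
    simp
  refine this.mono ?_
  rintro x ⟨hx, hne⟩
  have : 0 < |ψ x + -1 * χ x| := by
    rw [abs_pos]
    intro h
    exact hne (by linarith)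
  obtain ⟨j, hj⟩ := exists_nat_one_div_lt this
  exact Set.mem_iUnion.2 ⟨j, hx, hj⟩

theorem exists_isQuasiContRep {Ω : Set (RSpace n)} (hΩ : IsOpen Ω) (u : H10 Ω) :
    ∃ ψ, IsQuasiContRep u ψ := by
  have hu : (u : L2Pair n) ∈ closure (testPairs Ω : Set (L2Pair n)) := u.2
  have hap : ∀ j : ℕ, ∃ q : H10 Ω, ∃ φ : RSpace n → ℝ, ContDiff ℝ ∞ φ ∧ fn q =ᵐ[volume] φ ∧
      ‖q - u‖ ≤ (1 / 4) ^ j := by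
    intro j
    obtain ⟨q, hq, hd⟩ := Metric.mem_closure_iff.1 hu ((1 / 4) ^ j) (by positivity)
    obtain ⟨φ, h1, -, -, h4, -⟩ := id hq
    refine ⟨⟨q, Submodule.le_topologicalClosure _ hq⟩, φ, h1, h4, ?_⟩
    rw [dist_comm, dist_eq_norm] at hd
    exact hd.le
  choose q φ h1 h4 hd using hap
  -- Consecutive approximations differ by at most `2 · 4⁻ʲ` in norm, so Chebyshev's inequality at
  -- level `2⁻ʲ` gives the bound `3 · 2 · 4⁻ʲ / 2⁻ʲ = 6 · 2⁻ʲ`. Off a tail of these sets the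
  -- convergence is uniform.
  let E : ℕ → Set (RSpace n) := fun j => {x | (1 / 2) ^ j < |φ (j + 1) x - φ j x|}
  have hEo : ∀ j, IsOpen (E j) := fun j =>
    isOpen_lt continuous_const ((h1 _).continuous.sub (h1 _).continuous).abs
  have hE : ∀ j, CapLe Ω (E j) (6 * (1 / 2) ^ j) := by
    intro j
    refine (capLe_of_one_le (q (j + 1) - q j) (t := (1 / 2) ^ j) (by positivity) (hEo j)
      subset_rfl ?_).mono subset_rfl ?_
    · filter_upwards [fn_sub (q (j + 1)) (q j), h4 j, h4 (j + 1)] with x a b c hx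
      rw [a, b, c]
      exact le_of_lt hx
    · have h5 : ‖q (j + 1) - q j‖ ≤ 2 * (1 / 4) ^ j := by
        have e : q (j + 1) - q j = (q (j + 1) - u) - (q j - u) := by abel
        rw [e]
        refine (norm_sub_le _ _).trans ?_
        have := hd (j + 1)
        have := hd j
        have h0 : (0 : ℝ) < (1 / 4) ^ j := by positivity
        rw [pow_succ] at *
        linarith
      rw [div_le_iff₀ (by positivity)]
      have e : (6 : ℝ) * (1 / 2) ^ j * (1 / 2) ^ j = 6 * (1 / 4) ^ j := by
        rw [mul_assoc, ← mul_pow]; norm_num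
      rw [e]
      linarith
  let S : ℕ → Set (RSpace n) := fun m => ⋃ j, E (j + m)
  have hS : ∀ m, CapLe Ω (S m) (2 * 6 * (1 / 2) ^ m) := fun m => CapLe.iUnion_geometric hE m
  have hdist : ∀ m, ∀ x ∉ S m, ∀ j, dist (φ (j + m) x) (φ (j + 1 + m) x) ≤
      (1 / 2) ^ m * (1 / 2) ^ j := by
    intro m x hx j
    have h5 : x ∉ E (j + m) := fun h => hx (Set.mem_iUnion.2 ⟨j, h⟩)
    have h6 : |φ (j + m + 1) x - φ (j + m) x| ≤ (1 / 2) ^ (j + m) := not_lt.1 h5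
    rw [dist_comm, Real.dist_eq, ← pow_add, add_comm m j, add_right_comm]
    exact h6
  -- The value is arbitrary where the limit fails to exist; such points lie in every `S m`, a set of
  -- zero capacity.
  let ψ : RSpace n → ℝ := fun x => limUnder atTop fun j => φ j x
  have hlim : ∀ m, ∀ x ∉ S m, Tendsto (fun j => φ (j + m) x) atTop (𝓝 (ψ x)) := by
    intro m x hx
    have hc : CauchySeq fun j => φ (j + m) x :=
      cauchySeq_of_le_geometric _ _ (by norm_num) (hdist m x hx)
    have hc' : CauchySeq fun j => φ j x := (cauchySeq_shift m).1 hc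
    exact (hc'.tendsto_limUnder).comp (tendsto_add_atTop_nat m)
  have hcont : ∀ m, ContinuousOn ψ (S m)ᶜ := by
    intro m
    have hu : TendstoUniformlyOn (fun j x => φ (j + m) x) ψ atTop (S m)ᶜ := by
      rw [Metric.tendstoUniformlyOn_iff]
      intro ε hε
      have : Tendsto (fun j : ℕ => (1 / 2 : ℝ) ^ m * (1 / 2) ^ j / (1 - 1 / 2)) atTop
          (𝓝 ((1 / 2 : ℝ) ^ m * 0 / (1 - 1 / 2))) :=
        ((tendsto_pow_atTop_nhds_zero_of_lt_one (by norm_num) (by norm_num)).const_mul _).div_const _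
      rw [mul_zero, zero_div] at this
      filter_upwards [this.eventually (gt_mem_nhds hε)] with j hj x hx
      rw [dist_comm]
      exact (dist_le_of_le_geometric_of_tendsto _ _ (by norm_num) (hdist m x hx) (hlim m x hx)
        j).trans_lt hj
    exact hu.continuousOn (Frequently.of_forall fun j => (h1 _).continuous.continuousOn)
  refine ⟨ψ, quasiContinuousOn_of_capLe hΩ fun r hr => ?_, ae_restrict_of_ae ?_⟩
  · obtain ⟨m, hm⟩ := exists_pow_mul_le 6 hr
    exact ⟨S m, isOpen_iUnion fun j => hEo _, (hS m).mono subset_rfl hm,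
      (hcont m).mono fun x hx => hx.2⟩
  · have hq : Tendsto q atTop (𝓝 u) := by
      rw [tendsto_iff_norm_sub_tendsto_zero]
      exact squeeze_zero (fun _ => norm_nonneg _) hd
        (tendsto_pow_atTop_nhds_zero_of_lt_one (by norm_num) (by norm_num))
    have hq' : Tendsto (fun j => fnL Ω (q j)) atTop (𝓝 (fnL Ω u)) :=
      ((fnL Ω).continuous.tendsto u).comp hq
    obtain ⟨ns, hns, hae⟩ := (tendstoInMeasure_of_tendsto_Lp hq').exists_seq_tendsto_ae
    have hnull : volume (⋂ m, S m) = 0 := by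
      refine (CapNull.of_geometric hE fun m => ?_).volume_eq_zero
      exact Set.iInter_subset _ m
    have hns' : ∀ᵐ x, x ∉ ⋂ m, S m := measure_eq_zero_iff_ae_notMem.1 hnull
    filter_upwards [hae, hns', ae_all_iff.2 h4] with x a b c
    obtain ⟨m, hm⟩ : ∃ m, x ∉ S m := by simpa using b
    have l1 : Tendsto (fun j => φ j x) atTop (𝓝 (ψ x)) :=
      (tendsto_add_atTop_iff_nat m).1 (hlim m x hm)
    have l2 : Tendsto (fun j => φ (ns j) x) atTop (𝓝 (fn u x)) :=
      a.congr fun j => c (ns j)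
    exact tendsto_nhds_unique (l1.comp hns.tendsto_atTop) l2

theorem isQuasiContRep_qc {Ω : Set (RSpace n)} (hΩ : IsOpen Ω) (u : H10 Ω) :
    IsQuasiContRep u (qc u) :=
  Classical.epsilon_spec (exists_isQuasiContRep hΩ u)

/-- As `qc` is a choice, it is linear only up to sets of zero capacity, and these are negligible for
`μ`. -/
theorem qc_add_smul {Ω : Set (RSpace n)} (hΩ : IsOpen Ω) (hP : HasPoincare Ω)
    {μ : Measure (RSpace n)} (hμ : IsM0 Ω μ) (u v : H10 Ω) (c : ℝ) :
    qc (u + c • v) =ᵐ[μ.restrict Ω] fun x => qc u x + c * qc v x := by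
  have h := (isQuasiContRep_qc hΩ (u + c • v)).capNull_ne hΩ hP
    ((isQuasiContRep_qc hΩ u).add_const_mul hΩ hP (isQuasiContRep_qc hΩ v) c)
  refine (ae_restrict_iff' hΩ.measurableSet).2 ?_
  have h0 := h.measure_eq_zero hΩ (fun x hx => hx.1) hμ
  filter_upwards [measure_eq_zero_iff_ae_notMem.1 h0] with x hx hxΩ
  by_contra hne
  exact hx ⟨hxΩ, hne⟩

/-- Convergence in `H¹₀(Ω)` implies quasi-everywhere convergence of a subsequence. -/
theorem exists_tendsto_qc {Ω : Set (RSpace n)} (hΩ : IsOpen Ω) (hP : HasPoincare Ω)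
    {μ : Measure (RSpace n)} (hμ : IsM0 Ω μ) {u : ℕ → H10 Ω} {v : H10 Ω}
    (h : Tendsto u atTop (𝓝 v)) : ∃ ns : ℕ → ℕ, StrictMono ns ∧
      ∀ᵐ x ∂μ.restrict Ω, Tendsto (fun j => qc (u (ns j)) x) atTop (𝓝 (qc v x)) := by
  have hev : ∀ j : ℕ, ∀ᶠ k in atTop, ‖u k - v‖ ≤ (1 / 4) ^ j := fun j =>
    (tendsto_iff_norm_sub_tendsto_zero.1 h).eventually (ge_mem_nhds (by positivity))
  obtain ⟨ns, hns, hd⟩ := extraction_forall_of_eventually hev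
  refine ⟨ns, hns, ?_⟩
  let E : ℕ → Set (RSpace n) := fun j =>
    {x | x ∈ Ω ∧ (1 / 2) ^ j < |qc (u (ns j)) x + -1 * qc v x|}
  -- Chebyshev's inequality contributes `3 · 2⁻ʲ`, and quasi-continuity the error `r = 2⁻ʲ`.
  have hE : ∀ j, CapLe Ω (E j) (4 * (1 / 2) ^ j) := by
    intro j
    have h1 := (isQuasiContRep_qc hΩ (u (ns j))).add_const_mul hΩ hP (isQuasiContRep_qc hΩ v) (-1)
    refine (h1.capLe hΩ hP (t := (1 / 2) ^ j) (r := (1 / 2) ^ j) (by positivity)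
      (by positivity)).mono subset_rfl ?_
    have h2 := hd j
    rw [neg_one_smul, ← sub_eq_add_neg]
    have e : (3 : ℝ) * (1 / 2) ^ j * (1 / 2) ^ j = 3 * (1 / 4) ^ j := by
      rw [mul_assoc, ← mul_pow]; norm_num
    have h3 : 3 * ‖u (ns j) - v‖ / (1 / 2) ^ j ≤ 3 * (1 / 2) ^ j := by
      rw [div_le_iff₀ (by positivity), e]
      linarith
    linarith
  have hN : CapNull Ω (⋂ m, ⋃ j, E (j + m)) :=
    CapNull.of_geometric hE fun m => Set.iInter_subset _ m
  have h0 := hN.measure_eq_zero hΩ (fun x hx => by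
    obtain ⟨j, hj⟩ := Set.mem_iUnion.1 (Set.mem_iInter.1 hx 0)
    exact hj.1) hμ
  refine (ae_restrict_iff' hΩ.measurableSet).2 ?_
  filter_upwards [measure_eq_zero_iff_ae_notMem.1 h0] with x hx hxΩ
  obtain ⟨m, hm⟩ : ∃ m, x ∉ ⋃ j, E (j + m) := by simpa only [Set.mem_iInter, not_forall] using hx
  rw [← tendsto_add_atTop_iff_nat m, tendsto_iff_norm_sub_tendsto_zero]
  refine squeeze_zero (fun _ => norm_nonneg _) (fun j => ?_)
    ((tendsto_pow_atTop_nhds_zero_of_lt_one (r := (1 / 2 : ℝ)) (by norm_num) (by norm_num)).comp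
      (tendsto_add_atTop_nat m))
  have h5 : ¬ (1 / 2) ^ (j + m) < |qc (u (ns (j + m))) x + -1 * qc v x| := fun h =>
    hm (Set.mem_iUnion.2 ⟨j, hxΩ, h⟩)
  rw [not_lt, neg_one_mul, ← sub_eq_add_neg] at h5
  exact h5

/-! ### Closed subspaces of a product of two Hilbert spaces -/

section

variable {E F : Type*} [NormedAddCommGroup E] [InnerProductSpace ℝ E] [NormedAddCommGroup F]
  [InnerProductSpace ℝ F]

/-- Subspaces of the Hilbert sum of two Hilbert spaces. -/
abbrev SumSubmodule (E F : Type*) [NormedAddCommGroup E] [InnerProductSpace ℝ E]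
    [NormedAddCommGroup F] [InnerProductSpace ℝ F] := Submodule ℝ (WithLp 2 (E × F))

/-- A subspace of the Hilbert sum of two Hilbert spaces, as a type. -/
def SumSpace (S : SumSubmodule E F) : Type _ := ↥S

instance (S : SumSubmodule E F) : NormedAddCommGroup (SumSpace S) :=
  Submodule.normedAddCommGroup S

instance (S : SumSubmodule E F) : InnerProductSpace ℝ (SumSpace S) :=
  Submodule.innerProductSpace S

/-- The first component. -/
def SumSpace.fstL (S : SumSubmodule E F) : SumSpace S →L[ℝ] E :=
  ((WithLp.fstL 2 ℝ E F).comp S.subtypeL : S →L[ℝ] E)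

/-- The second component. -/
def SumSpace.sndL (S : SumSubmodule E F) : SumSpace S →L[ℝ] F :=
  ((WithLp.sndL 2 ℝ E F).comp S.subtypeL : S →L[ℝ] F)

theorem SumSpace.norm_sq (S : SumSubmodule E F) (p : SumSpace S) :
    ‖p‖ ^ 2 = ‖SumSpace.fstL S p‖ ^ 2 + ‖SumSpace.sndL S p‖ ^ 2 :=
  WithLp.prod_norm_sq_eq_of_L2 (Subtype.val p : WithLp 2 (E × F))

theorem SumSpace.completeSpace [CompleteSpace E] [CompleteSpace F] {S : SumSubmodule E F}
    (hS : IsClosed (S : Set (WithLp 2 (E × F)))) : CompleteSpace (SumSpace S) :=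
  hS.completeSpace_coe

end

/-! ### The Hilbert space `H¹₀(Ω) ∩ L²_μ(Ω)` -/

/-- `H¹₀(Ω) ∩ L²_μ(Ω)` as the graph of the embedding of `H¹₀(Ω)` into functions modulo `μ`. -/
def relaxedSpace {Ω : Set (RSpace n)} (hΩ : IsOpen Ω) (hP : HasPoincare Ω)
    {μ : Measure (RSpace n)} (hμ : IsM0 Ω μ) :
    SumSubmodule (H10 Ω) (Lp ℝ 2 (μ.restrict Ω)) where
  carrier := {p | qc p.fst =ᵐ[μ.restrict Ω] p.snd}
  zero_mem' := by
    -- Even `qc 0` is a choice; writing `0 = 0 + (-1) • 0` shows that it vanishes `μ`-almost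
    -- everywhere.
    have h := qc_add_smul hΩ hP hμ (0 : H10 Ω) 0 (-1)
    rw [smul_zero, add_zero] at h
    filter_upwards [h, Lp.coeFn_zero ℝ 2 (μ.restrict Ω)] with x a b
    rw [WithLp.zero_snd, b, WithLp.zero_fst, a]
    simp
  add_mem' := by
    intro p q hp hq
    have h := qc_add_smul hΩ hP hμ p.fst q.fst 1
    rw [one_smul] at h
    filter_upwards [h, hp, hq, Lp.coeFn_add p.snd q.snd] with x a b c d
    rw [WithLp.add_snd, WithLp.add_fst, a, b, c, d, Pi.add_apply, one_mul]
  smul_mem' := by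
    intro c p hp
    have h0 := qc_add_smul hΩ hP hμ (0 : H10 Ω) 0 (-1)
    rw [smul_zero, add_zero] at h0
    have h := qc_add_smul hΩ hP hμ 0 p.fst c
    rw [zero_add] at h
    filter_upwards [h0, h, hp, Lp.coeFn_smul c p.snd] with x z a b d
    rw [WithLp.smul_snd, WithLp.smul_fst, a, b, d, Pi.smul_apply, smul_eq_mul]
    linarith

theorem isClosed_relaxedSpace {Ω : Set (RSpace n)} (hΩ : IsOpen Ω) (hP : HasPoincare Ω)
    {μ : Measure (RSpace n)} (hμ : IsM0 Ω μ) :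
    IsClosed (relaxedSpace hΩ hP hμ : Set (WithLp 2 (H10 Ω × Lp ℝ 2 (μ.restrict Ω)))) := by
  refine IsSeqClosed.isClosed fun p q hp hlim => ?_
  have h1 : Tendsto (fun j => (p j).fst) atTop (𝓝 q.fst) :=
    ((WithLp.fstL 2 ℝ _ _).continuous.tendsto q).comp hlim
  have h2 : Tendsto (fun j => (p j).snd) atTop (𝓝 q.snd) :=
    ((WithLp.sndL 2 ℝ _ _).continuous.tendsto q).comp hlim
  -- Along one common subsequence the representatives converge `μ`-almost everywhere to `qc q.fst`,
  -- and the `L²_μ` components to `q.snd`.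
  obtain ⟨ns, hns, h3⟩ := exists_tendsto_qc hΩ hP hμ h1
  obtain ⟨ms, hms, h4⟩ :=
    (tendstoInMeasure_of_tendsto_Lp (h2.comp hns.tendsto_atTop)).exists_seq_tendsto_ae
  have h5 : ∀ᵐ x ∂μ.restrict Ω, ∀ j, qc (p j).fst x = (p j).snd x := ae_all_iff.2 hp
  change qc q.fst =ᵐ[μ.restrict Ω] q.snd
  filter_upwards [h3, h4, h5] with x a b c
  refine tendsto_nhds_unique (a.comp hms.tendsto_atTop) (b.congr fun j => ?_)
  exact (c _).symm

section

variable {Ω : Set (RSpace n)} {hΩ : IsOpen Ω} {hP : HasPoincare Ω}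
  {μ : Measure (RSpace n)} {hμ : IsM0 Ω μ}

/-- The Hilbert space `H¹₀(Ω) ∩ L²_μ(Ω)`. -/
abbrev RelaxedSpace (hΩ : IsOpen Ω) (hP : HasPoincare Ω) (hμ : IsM0 Ω μ) : Type :=
  SumSpace (relaxedSpace hΩ hP hμ)

instance : CompleteSpace (RelaxedSpace hΩ hP hμ) :=
  SumSpace.completeSpace (isClosed_relaxedSpace hΩ hP hμ)

/-- The gradient, as a bounded operator on `H¹₀(Ω)`. -/
def gradL (Ω : Set (RSpace n)) : H10 Ω →L[ℝ] Lp (RSpace n) 2 (volume : Measure (RSpace n)) :=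
  (WithLp.sndL 2 ℝ _ _).comp (H10 Ω).subtypeL

/-- The inclusion of `H¹₀(Ω) ∩ L²_μ(Ω)` into `H¹₀(Ω)`. -/
def toH10 (hΩ : IsOpen Ω) (hP : HasPoincare Ω) (hμ : IsM0 Ω μ) :
    RelaxedSpace hΩ hP hμ →L[ℝ] H10 Ω :=
  SumSpace.fstL (relaxedSpace hΩ hP hμ)

/-- The inclusion of `H¹₀(Ω) ∩ L²_μ(Ω)` into `L²_μ(Ω)`. -/
def toL2 (hΩ : IsOpen Ω) (hP : HasPoincare Ω) (hμ : IsM0 Ω μ) :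
    RelaxedSpace hΩ hP hμ →L[ℝ] Lp ℝ 2 (μ.restrict Ω) :=
  SumSpace.sndL (relaxedSpace hΩ hP hμ)

theorem norm_sq_relaxedSpace (p : RelaxedSpace hΩ hP hμ) :
    ‖p‖ ^ 2 = ‖toH10 hΩ hP hμ p‖ ^ 2 + ‖toL2 hΩ hP hμ p‖ ^ 2 :=
  SumSpace.norm_sq _ p

theorem qc_toH10 (p : RelaxedSpace hΩ hP hμ) :
    qc (toH10 hΩ hP hμ p) =ᵐ[μ.restrict Ω] toL2 hΩ hP hμ p :=
  Subtype.property p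

theorem mem_X_iff {u : H10 Ω} : u ∈ X Ω μ ↔ ∃ p, toH10 hΩ hP hμ p = u := by
  constructor
  · intro h
    let p : ↥(relaxedSpace hΩ hP hμ) :=
      ⟨WithLp.toLp 2 (u, MemLp.toLp _ h), (MemLp.coeFn_toLp h).symm⟩
    exact ⟨p, rfl⟩
  · rintro ⟨p, rfl⟩
    exact (Lp.memLp (toL2 hΩ hP hμ p)).ae_eq (qc_toH10 p).symm

/-- The bilinear form of the relaxed Dirichlet problem. -/
def relaxedForm (a : Matrix (Fin n) (Fin n) ℝ) (p q : RelaxedSpace hΩ hP hμ) : ℝ :=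
  inner ℝ (matOp a (gradL Ω (toH10 hΩ hP hμ p))) (gradL Ω (toH10 hΩ hP hμ q)) +
    inner ℝ (toL2 hΩ hP hμ p) (toL2 hΩ hP hμ q)

theorem relaxedForm_eq (a : Matrix (Fin n) (Fin n) ℝ) (p q : RelaxedSpace hΩ hP hμ) :
    relaxedForm a p q = energy a Ω (toH10 hΩ hP hμ p) (toH10 hΩ hP hμ q) +
      ∫ x in Ω, qc (toH10 hΩ hP hμ p) x * qc (toH10 hΩ hP hμ q) x ∂μ := by
  have e1 := energy_eq a hΩ.measurableSet (toH10 hΩ hP hμ p).2 (toH10 hΩ hP hμ q)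
  have e2 : inner ℝ (toL2 hΩ hP hμ p) (toL2 hΩ hP hμ q)
      = ∫ x in Ω, qc (toH10 hΩ hP hμ p) x * qc (toH10 hΩ hP hμ q) x ∂μ := by
    rw [L2.inner_def]
    refine integral_congr_ae ?_
    filter_upwards [qc_toH10 p, qc_toH10 q] with x e1 e2
    rw [e1, e2, RCLike.inner_apply, conj_trivial, mul_comm]
  exact congrArg₂ (· + ·) e1.symm e2

theorem relaxedForm_comm (a : Matrix (Fin n) (Fin n) ℝ) (p q : RelaxedSpace hΩ hP hμ) :
    relaxedForm a p q = relaxedForm a q p := by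
  rw [relaxedForm, relaxedForm, real_inner_comm (toL2 hΩ hP hμ p)]
  congr 1
  exact inner_matOp_comm a (toH10 hΩ hP hμ p).2 (toH10 hΩ hP hμ q).2

theorem relaxedForm_sub_right (a : Matrix (Fin n) (Fin n) ℝ) (p q r : RelaxedSpace hΩ hP hμ) :
    relaxedForm a p (q - r) = relaxedForm a p q - relaxedForm a p r := by
  simp only [relaxedForm, map_sub, inner_sub_right]
  ring

theorem isRelaxedSol_iff {a : Matrix (Fin n) (Fin n) ℝ} {g : Hdual Ω} {w : H10 Ω} :
    IsRelaxedSol a μ g w ↔ ∃ p, toH10 hΩ hP hμ p = w ∧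
      ∀ q, relaxedForm a p q = g (toH10 hΩ hP hμ q) := by
  constructor
  · rintro ⟨hw, h⟩
    obtain ⟨p, rfl⟩ := (mem_X_iff (hΩ := hΩ) (hP := hP) (hμ := hμ)).1 hw
    exact ⟨p, rfl, fun q => (relaxedForm_eq a p q).trans (h _ (mem_X_iff.2 ⟨q, rfl⟩))⟩
  · rintro ⟨p, rfl, h⟩
    refine ⟨mem_X_iff.2 ⟨p, rfl⟩, fun φ hφ => ?_⟩
    obtain ⟨q, rfl⟩ := (mem_X_iff (hΩ := hΩ) (hP := hP) (hμ := hμ)).1 hφ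
    rw [← relaxedForm_eq, h]

theorem norm_gradL_le (u : H10 Ω) : ‖gradL Ω u‖ ≤ ‖u‖ := by
  have h2 : ‖u‖ ^ 2 = ‖(u : L2Pair n).fst‖ ^ 2 + ‖gradL Ω u‖ ^ 2 :=
    WithLp.prod_norm_sq_eq_of_L2 (u : L2Pair n)
  refine (sq_le_sq₀ (norm_nonneg _) (norm_nonneg _)).1 ?_
  nlinarith [sq_nonneg ‖(u : L2Pair n).fst‖]

theorem relaxedForm_le (a : Matrix (Fin n) (Fin n) ℝ) (p q : RelaxedSpace hΩ hP hμ) :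
    relaxedForm a p q ≤ (‖matOp a‖ + 1) * (‖p‖ * ‖q‖) := by
  have h : ∀ p : RelaxedSpace hΩ hP hμ, ‖gradL Ω (toH10 hΩ hP hμ p)‖ ≤ ‖p‖ ∧
      ‖toL2 hΩ hP hμ p‖ ≤ ‖p‖ := by
    intro p
    have e := norm_sq_relaxedSpace p
    refine ⟨(norm_gradL_le _).trans ?_, ?_⟩ <;>
    · refine (sq_le_sq₀ (norm_nonneg _) (norm_nonneg _)).1 ?_
      have h1 := sq_nonneg ‖toH10 hΩ hP hμ p‖
      have h2 := sq_nonneg ‖toL2 hΩ hP hμ p‖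
      linarith
  obtain ⟨p1, p2⟩ := h p
  obtain ⟨q1, q2⟩ := h q
  rw [add_mul, one_mul]
  refine add_le_add ?_ ?_
  · calc _ ≤ ‖matOp a (gradL Ω (toH10 hΩ hP hμ p))‖ * ‖gradL Ω (toH10 hΩ hP hμ q)‖ :=
        real_inner_le_norm _ _
      _ ≤ (‖matOp a‖ * ‖p‖) * ‖q‖ := by
        gcongr
        exact (matOp a).le_opNorm_of_le p1
      _ = _ := by ring
  · calc _ ≤ ‖toL2 hΩ hP hμ p‖ * ‖toL2 hΩ hP hμ q‖ := real_inner_le_norm _ _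
      _ ≤ _ := by gcongr

theorem exists_le_relaxedForm (hΩ : IsOpen Ω) (hP : HasPoincare Ω) (hμ : IsM0 Ω μ)
    {a : Matrix (Fin n) (Fin n) ℝ} (ha : Elliptic a) : ∃ c : ℝ, 0 < c ∧
      ∀ p : RelaxedSpace hΩ hP hμ, c * ‖p‖ ^ 2 ≤ relaxedForm a p p := by
  obtain ⟨γ, hγ, ha⟩ := ha
  obtain ⟨K, hK, hKu⟩ := hP.exists_norm_le
  refine ⟨min (γ / K ^ 2) 1, by positivity, fun p => ?_⟩
  have h1 := le_inner_matOp ha (gradL Ω (toH10 hΩ hP hμ p))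
  have h2 : ‖toH10 hΩ hP hμ p‖ ^ 2 ≤ (K * ‖gradL Ω (toH10 hΩ hP hμ p)‖) ^ 2 := by
    gcongr
    exact hKu _
  rw [norm_sq_relaxedSpace, relaxedForm, real_inner_self_eq_norm_sq, mul_add]
  refine add_le_add ?_ ?_
  · calc _ ≤ γ / K ^ 2 * (K * ‖gradL Ω (toH10 hΩ hP hμ p)‖) ^ 2 :=
          mul_le_mul (min_le_left _ _) h2 (by positivity) (by positivity)
      _ = γ * ‖gradL Ω (toH10 hΩ hP hμ p)‖ ^ 2 := by field_simp
      _ ≤ _ := h1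
  · calc _ ≤ 1 * ‖toL2 hΩ hP hμ p‖ ^ 2 :=
          mul_le_mul_of_nonneg_right (min_le_right _ _) (by positivity)
      _ = _ := one_mul _

/-! ### Existence and uniqueness -/

/-- The Lax–Milgram theorem. -/
theorem existsUnique_of_coercive {H : Type*} [NormedAddCommGroup H] [InnerProductSpace ℝ H]
    [CompleteSpace H] {B : H →L[ℝ] H →L[ℝ] ℝ} (hB : IsCoercive B) (ℓ : StrongDual ℝ H) :
    ∃! p, ∀ q, B p q = ℓ q := by
  have hz : ∀ q, inner ℝ ((InnerProductSpace.toDual ℝ H).symm ℓ) q = ℓ q := fun q =>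
    InnerProductSpace.toDual_symm_apply
  refine ⟨hB.continuousLinearEquivOfBilin.symm ((InnerProductSpace.toDual ℝ H).symm ℓ),
    fun q => ?_, fun p hp => ?_⟩
  · rw [← hB.continuousLinearEquivOfBilin_apply, ContinuousLinearEquiv.apply_symm_apply, hz]
  · rw [ContinuousLinearEquiv.eq_symm_apply]
    exact (hB.unique_continuousLinearEquivOfBilin fun q => (hz q).trans (hp q).symm).symm

/-- The bilinear form of the relaxed Dirichlet problem with the additional term
`t ∫ u v dx`. -/
def resolventForm (hΩ : IsOpen Ω) (hP : HasPoincare Ω) (hμ : IsM0 Ω μ)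
    (a : Matrix (Fin n) (Fin n) ℝ) (t : ℝ) :
    RelaxedSpace hΩ hP hμ →L[ℝ] RelaxedSpace hΩ hP hμ →L[ℝ] ℝ :=
  let D := (gradL Ω).comp (toH10 hΩ hP hμ)
  let T := toL2 hΩ hP hμ
  let F := (fnL Ω).comp (toH10 hΩ hP hμ)
  (innerSL ℝ).bilinearComp ((matOp a).comp D) D + (innerSL ℝ).bilinearComp T T +
    t • (innerSL ℝ).bilinearComp F F

theorem resolventForm_apply (a : Matrix (Fin n) (Fin n) ℝ) (t : ℝ)
    (p q : RelaxedSpace hΩ hP hμ) : resolventForm hΩ hP hμ a t p q =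
      relaxedForm a p q + t * inner ℝ (fnL Ω (toH10 hΩ hP hμ p)) (fnL Ω (toH10 hΩ hP hμ q)) := rfl

/-- Used with `t = 0` for the problem itself and with `t > 0` for the approximation in `L²`. -/
theorem existsUnique_resolvent {a : Matrix (Fin n) (Fin n) ℝ} (ha : Elliptic a) {t : ℝ}
    (ht : 0 ≤ t) (g : Hdual Ω) : ∃! p : RelaxedSpace hΩ hP hμ, ∀ q,
      relaxedForm a p q + t * inner ℝ (fnL Ω (toH10 hΩ hP hμ p)) (fnL Ω (toH10 hΩ hP hμ q))
        = g (toH10 hΩ hP hμ q) := by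
  obtain ⟨c, hc, h⟩ := exists_le_relaxedForm hΩ hP hμ ha
  refine existsUnique_of_coercive (B := resolventForm hΩ hP hμ a t) ⟨c, hc, fun p => ?_⟩
    (g.comp (toH10 hΩ hP hμ))
  rw [resolventForm_apply, real_inner_self_eq_norm_sq, mul_assoc, ← sq]
  have := h p
  have : 0 ≤ t * ‖fnL Ω (toH10 hΩ hP hμ p)‖ ^ 2 := by positivity
  linarith

theorem existsUnique_isRelaxedSol (hΩ : IsOpen Ω) (hP : HasPoincare Ω) (hμ : IsM0 Ω μ)
    {a : Matrix (Fin n) (Fin n) ℝ} (ha : Elliptic a) (g : Hdual Ω) :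
    ∃! w : H10 Ω, IsRelaxedSol a μ g w := by
  obtain ⟨p, hp, hu⟩ := existsUnique_resolvent (hΩ := hΩ) (hP := hP) (hμ := hμ) ha le_rfl g
  simp only [zero_mul, add_zero] at hp hu
  refine ⟨toH10 hΩ hP hμ p, isRelaxedSol_iff.2 ⟨p, rfl, hp⟩, fun w hw => ?_⟩
  obtain ⟨p', rfl, hp'⟩ := (isRelaxedSol_iff (hΩ := hΩ) (hP := hP) (hμ := hμ)).1 hw
  rw [hu p' hp']

theorem isRelaxedSol_solOp (hΩ : IsOpen Ω) (hP : HasPoincare Ω) (hμ : IsM0 Ω μ)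
    {a : Matrix (Fin n) (Fin n) ℝ} (ha : Elliptic a) (g : Hdual Ω) :
    IsRelaxedSol a μ g (solOp a μ g) :=
  Classical.epsilon_spec (existsUnique_isRelaxedSol hΩ hP hμ ha g).exists

theorem eq_solOp (hΩ : IsOpen Ω) (hP : HasPoincare Ω) (hμ : IsM0 Ω μ)
    {a : Matrix (Fin n) (Fin n) ℝ} (ha : Elliptic a) {g : Hdual Ω} {w : H10 Ω}
    (h : IsRelaxedSol a μ g w) : w = solOp a μ g :=
  (existsUnique_isRelaxedSol hΩ hP hμ ha g).unique h (isRelaxedSol_solOp hΩ hP hμ ha g)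

theorem HasPoincare.mono {U : Set (RSpace n)} (hP : HasPoincare Ω) (h : U ⊆ Ω) :
    HasPoincare U := by
  obtain ⟨C, hC, hp⟩ := hP
  exact ⟨C, hC, fun p h' => hp p (H10_mono h h')⟩

/-- `IsLimitMeasure` speaks about given sequences of solutions, so it yields information only once
they are known to exist. -/
theorem exists_isDirichletSol (hP : HasPoincare Ω) {U : Set (RSpace n)} (hU : IsOpen U)
    (hUΩ : U ⊆ Ω) {a : Matrix (Fin n) (Fin n) ℝ} (ha : Elliptic a) (g : Hdual Ω) :
    ∃ z : H10 Ω, IsDirichletSol a U g z := by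
  obtain ⟨γ, hγ, ha⟩ := ha
  obtain ⟨K, hK, hKu⟩ := (hP.mono hUΩ).exists_norm_le
  let B : H10 U →L[ℝ] H10 U →L[ℝ] ℝ :=
    (innerSL ℝ).bilinearComp ((matOp a).comp (gradL U)) (gradL U)
  have hB : IsCoercive B := by
    refine ⟨γ / K ^ 2, by positivity, fun u => ?_⟩
    have h1 : γ * ‖gradL U u‖ ^ 2 ≤ B u u := le_inner_matOp ha (gradL U u)
    refine le_trans ?_ h1
    have h2 : ‖u‖ ≤ K * ‖gradL U u‖ := hKu u
    calc γ / K ^ 2 * ‖u‖ * ‖u‖ ≤ γ / K ^ 2 * (K * ‖gradL U u‖) * (K * ‖gradL U u‖) := by gcongr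
      _ = _ := by field_simp
  let ι : H10 U →L[ℝ] H10 Ω :=
    (H10 U).subtypeL.codRestrict (H10 Ω) fun u => H10_mono hUΩ u.2
  obtain ⟨z, hz, -⟩ := existsUnique_of_coercive hB (g.comp ι)
  refine ⟨ι z, z.2, fun φ hφ => ?_⟩
  rw [energy_eq a hU.measurableSet (u := ι z) z.2]
  exact hz ⟨φ, hφ⟩

end

section

variable {Ω : Set (RSpace n)} {μ : Measure (RSpace n)}

/-! ### The space `H¹₀(Ω) ∩ L²_μ(Ω)` depends only on the sequence of open sets -/

theorem l2Functional_eq_inner (z φ : H10 Ω) :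
    l2Functional z φ = inner ℝ (fnL Ω z) (fnL Ω φ) := rfl

/-- A bounded sequence has a weak limit in the Hilbert space `H¹₀ ∩ L²_μ`, and an element of `H¹₀`
is determined by its function, so convergence in `L²` suffices. -/
theorem mem_X_of_bounded (hΩ : IsOpen Ω) (hP : HasPoincare Ω) (hμ : IsM0 Ω μ)
    {p : ℕ → RelaxedSpace hΩ hP hμ} {C : ℝ} (hp : ∀ j, ‖p j‖ ≤ C) {u : H10 Ω}
    (h : Tendsto (fun j => fnL Ω (toH10 hΩ hP hμ (p j))) atTop (𝓝 (fnL Ω u))) : u ∈ X Ω μ := by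
  obtain ⟨q, hq, -⟩ := exists_eq_of_tendsto ((fnL Ω).comp (toH10 hΩ hP hμ)) hp h
  exact mem_X_iff.2 ⟨q, H10_ext hq⟩

theorem IsDirichletSol.eq_inner {a : Matrix (Fin n) (Fin n) ℝ} {U : Set (RSpace n)}
    (hU : IsOpen U) {g : Hdual Ω} {z φ : H10 Ω} (h : IsDirichletSol a U g z)
    (hφ : (φ : L2Pair n) ∈ H10 U) :
    inner ℝ (matOp a (gradL Ω z)) (gradL Ω φ) = g φ := by
  rw [← h.2 φ hφ, energy_eq a hU.measurableSet h.1]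
  rfl

/-- The function `u` is approximated by elements of `H¹₀(Uₖ)` whose norms are eventually at most
`C`. -/
def IsBoundedLimit (Ω : Set (RSpace n)) (U : ℕ → Set (RSpace n)) (C : ℝ) (u : H10 Ω) : Prop :=
  ∃ z : ℕ → H10 Ω, (∀ k, (z k : L2Pair n) ∈ H10 (U k)) ∧ (∀ᶠ k in atTop, ‖z k‖ ≤ C) ∧
    ∀ ℓ : Hdual Ω, Tendsto (fun k => ℓ (z k)) atTop (𝓝 (ℓ u))

variable {a : Matrix (Fin n) (Fin n) ℝ} {U : ℕ → Set (RSpace n)}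

/-- The resolvent of the relaxed Dirichlet problem: the solution of `A w + μ w + t w = t ψ`. -/
theorem exists_resolvent (hΩ : IsOpen Ω) (hP : HasPoincare Ω) (hμ : IsM0 Ω μ)
    (ha : Elliptic a) {t : ℝ} (ht : 0 < t) (ψ : H10 Ω) :
    ∃ (p : RelaxedSpace hΩ hP hμ) (u : H10 Ω) (g : Hdual Ω), toH10 hΩ hP hμ p = u ∧
      u = solOp a μ g ∧ (∀ q, relaxedForm a p q = g (toH10 hΩ hP hμ q)) ∧
      ∀ v, g v = t * inner ℝ (fnL Ω ψ - fnL Ω u) (fnL Ω v) := by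
  obtain ⟨p, hp, -⟩ := existsUnique_resolvent (hΩ := hΩ) (hP := hP) (hμ := hμ) ha ht.le
    (t • l2Functional ψ)
  obtain ⟨g, hg'⟩ : ∃ g : Hdual Ω,
      ∀ v, g v = t * inner ℝ (fnL Ω ψ - fnL Ω (toH10 hΩ hP hμ p)) (fnL Ω v) :=
    ⟨t • l2Functional (ψ - toH10 hΩ hP hμ p), fun v => by rw [← map_sub]; rfl⟩
  have hg : ∀ q, relaxedForm a p q = g (toH10 hΩ hP hμ q) := by
    intro q
    have h1 := hp q
    have h3 : (t • l2Functional ψ) (toH10 hΩ hP hμ q)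
        = t * inner ℝ (fnL Ω ψ) (fnL Ω (toH10 hΩ hP hμ q)) := rfl
    rw [h3] at h1
    rw [hg', inner_sub_left, mul_sub]
    linarith
  exact ⟨p, _, g, rfl, eq_solOp hΩ hP hμ ha (isRelaxedSol_iff.2 ⟨p, rfl, hg⟩), hg, hg'⟩

/-- Coercivity and boundedness give `c x² ≤ M x y`, hence `c x ≤ M y`, which removes `x` from the
bound on `R`. -/
theorem le_of_quadratic_le {c M x y Q d R : ℝ} (hc : 0 < c) (hM : 0 ≤ M) (hx : 0 ≤ x)
    (hy : 0 ≤ y) (hd : 0 ≤ d) (hQ : c * x ^ 2 ≤ Q) (hR : R ≤ M * (x * y)) (h : Q + d = R) :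
    R ≤ M ^ 2 / c * y ^ 2 := by
  have h1 : c * x ≤ M * y := by
    rcases eq_or_lt_of_le hx with h0 | h0
    · rw [← h0, mul_zero]; positivity
    · refine le_of_mul_le_mul_right ?_ h0
      nlinarith
  calc R ≤ M * (x * y) := hR
    _ = M * y / c * (c * x) := by field_simp
    _ ≤ M * y / c * (M * y) := by gcongr
    _ = M ^ 2 / c * y ^ 2 := by ring

theorem le_of_add_sq_le {C P s : ℝ} (hC : 0 ≤ C) (hP : 0 ≤ P) (hs : 0 ≤ s)
    (h : (P + s) ^ 2 ≤ C * s) : s ≤ C ∧ P ≤ C := by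
  have h1 : s ≤ C := by
    rcases eq_or_lt_of_le hs with h0 | h0
    · rwa [← h0]
    · refine le_of_mul_le_mul_right ?_ h0
      nlinarith
  refine ⟨h1, (sq_le_sq₀ hP hC).1 ?_⟩
  nlinarith

/-- The energy estimate for the resolvent. -/
theorem exists_resolvent_le (hΩ : IsOpen Ω) (hP : HasPoincare Ω) (hμ : IsM0 Ω μ)
    (ha : Elliptic a) {ψ : H10 Ω} (hψ : ψ ∈ X Ω μ) : ∃ C : ℝ, 0 ≤ C ∧ ∀ t : ℝ, 0 < t →
      ∃ (g : Hdual Ω) (u : H10 Ω), u = solOp a μ g ∧ g u ≤ C ∧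
        t * ‖fnL Ω u - fnL Ω ψ‖ ^ 2 ≤ C := by
  obtain ⟨p, rfl⟩ := (mem_X_iff (hΩ := hΩ) (hP := hP) (hμ := hμ)).1 hψ
  obtain ⟨c, hc, hcoe⟩ := exists_le_relaxedForm hΩ hP hμ ha
  refine ⟨(‖matOp a‖ + 1) ^ 2 / c * ‖p‖ ^ 2, by positivity, fun t ht => ?_⟩
  obtain ⟨w, u, g, hwu, hu, hg, hg'⟩ := exists_resolvent hΩ hP hμ ha ht (toH10 hΩ hP hμ p)
  have hE : relaxedForm a w w + t * ‖fnL Ω u - fnL Ω (toH10 hΩ hP hμ p)‖ ^ 2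
      = relaxedForm a w p := by
    -- The test function `w - p` is admissible because `ψ`, the image of `p`, lies in `X Ω μ`. It
    -- turns the right side into `-t‖u - ψ‖²`.
    have h1 := hg (w - p)
    rw [relaxedForm_sub_right, hg', map_sub, hwu, map_sub, ← neg_sub (fnL Ω u), inner_neg_left,
      real_inner_self_eq_norm_sq] at h1
    linarith
  have hd : 0 ≤ t * ‖fnL Ω u - fnL Ω (toH10 hΩ hP hμ p)‖ ^ 2 := by positivity
  have hw := hcoe w
  have h0 : 0 ≤ c * ‖w‖ ^ 2 := by positivity
  have hb := le_of_quadratic_le hc (by positivity) (norm_nonneg w) (norm_nonneg p) hd hw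
    (relaxedForm_le a w p) hE
  have h1 : relaxedForm a w w = g u := (hg w).trans (congrArg g hwu)
  exact ⟨g, u, hu, by linarith, by linarith⟩

/-- Every element of `H¹₀(Ω) ∩ L²_μ(Ω)` is a limit in `L²(Ω)` of functions which are weak limits
from `H¹₀(Uₖ)` with uniform bounds. -/
theorem exists_isBoundedLimit (hΩ : IsOpen Ω) (hP : HasPoincare Ω) (hμ : IsM0 Ω μ)
    (ha : Elliptic a) (hU : ∀ k, IsOpen (U k) ∧ U k ⊆ Ω) (hL : IsLimitMeasure a Ω U μ)
    {ψ : H10 Ω} (hψ : ψ ∈ X Ω μ) : ∃ C : ℝ, ∀ t : ℝ, 0 < t → ∃ u : H10 Ω,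
      IsBoundedLimit Ω U C u ∧ t * ‖fnL Ω u - fnL Ω ψ‖ ^ 2 ≤ C := by
  obtain ⟨C₀, hC₀, h⟩ := exists_resolvent_le hΩ hP hμ ha hψ
  obtain ⟨K, hK, hKu⟩ := hP.exists_norm_le
  have ha' := ha
  obtain ⟨γ, hγ, haγ⟩ := ha'
  refine ⟨max C₀ (K * √((C₀ + 1) / γ)), fun t ht => ?_⟩
  obtain ⟨g, u, hu, hg, hgt⟩ := h t ht
  choose z hz using fun k => exists_isDirichletSol hP (hU k).1 (hU k).2 ha g
  have hlim := hL g z hz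
  rw [← hu] at hlim
  refine ⟨u, ⟨z, fun k => (hz k).1, ?_, hlim⟩, hgt.trans (le_max_left _ _)⟩
  -- The energies `g (z k)` tend to `g u ≤ C₀`, so they are eventually below `C₀ + 1`. By
  -- ellipticity they control the gradients, with constants that do not involve `t`.
  filter_upwards [(hlim g).eventually (gt_mem_nhds (lt_of_le_of_lt hg (lt_add_one C₀)))] with k hk
  have h1 := le_inner_matOp haγ (gradL Ω (z k))
  rw [(hz k).eq_inner (hU k).1 (hz k).1] at h1
  have h2 : ‖gradL Ω (z k)‖ ≤ √((C₀ + 1) / γ) := by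
    refine Real.le_sqrt_of_sq_le ?_
    rw [le_div_iff₀ hγ]
    linarith
  calc ‖z k‖ ≤ K * ‖gradL Ω (z k)‖ := hKu _
    _ ≤ K * √((C₀ + 1) / γ) := mul_le_mul_of_nonneg_left h2 hK.le
    _ ≤ _ := le_max_right _ _

/-- The elements `v k` tending to `u` are admissible tests for the problems in `U k`. So `|g (v k)|`
is at most a constant times `‖∇zₖ‖`, while `γ‖∇zₖ‖² ≤ g (z k)`. In the limit `u` is dominated by the
energy of the limit problem for this operator, whichever operator produced `u`. -/
theorem IsBoundedLimit.sq_le (hP : HasPoincare Ω)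
    (ha : Elliptic a) (hU : ∀ k, IsOpen (U k) ∧ U k ⊆ Ω) (hL : IsLimitMeasure a Ω U μ) (C : ℝ) :
    ∃ C' : ℝ, 0 ≤ C' ∧ ∀ (u : H10 Ω) (g : Hdual Ω), IsBoundedLimit Ω U C u →
      (g u) ^ 2 ≤ C' * g (solOp a μ g) := by
  have ha' := ha
  obtain ⟨γ, hγ, haγ⟩ := ha'
  refine ⟨‖matOp a‖ ^ 2 * C ^ 2 / γ, by positivity, fun u g hu => ?_⟩
  obtain ⟨v, hv, hvC, hvu⟩ := hu
  choose z hz using fun k => exists_isDirichletSol hP (hU k).1 (hU k).2 ha g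
  have hlim := hL g z hz
  refine le_of_tendsto_of_tendsto ((hvu g).pow 2) ((hlim g).const_mul _) ?_
  filter_upwards [hvC] with k hk
  have h1 := le_inner_matOp haγ (gradL Ω (z k))
  rw [(hz k).eq_inner (hU k).1 (hz k).1] at h1
  have h2 : |g (v k)| ≤ ‖matOp a‖ * ‖gradL Ω (z k)‖ * C := by
    rw [← (hz k).eq_inner (hU k).1 (hv k)]
    refine (abs_real_inner_le_norm _ _).trans ?_
    have := (matOp a).le_opNorm (gradL Ω (z k))
    have := (norm_gradL_le (v k)).trans hk
    gcongr
  calc (g (v k)) ^ 2 = |g (v k)| ^ 2 := (sq_abs _).symm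
    _ ≤ (‖matOp a‖ * ‖gradL Ω (z k)‖ * C) ^ 2 := by gcongr
    _ = ‖matOp a‖ ^ 2 * C ^ 2 / γ * (γ * ‖gradL Ω (z k)‖ ^ 2) := by field_simp
    _ ≤ _ := by gcongr

/-- The function `u` need not be known to lie in `X Ω μ`, so the resolvent equation cannot be tested
with it; the inequality of `IsBoundedLimit.sq_le` takes the place of that test. -/
theorem IsBoundedLimit.exists_near (hΩ : IsOpen Ω) (hP : HasPoincare Ω) (hμ : IsM0 Ω μ)
    (ha : Elliptic a) (hU : ∀ k, IsOpen (U k) ∧ U k ⊆ Ω) (hL : IsLimitMeasure a Ω U μ) (C : ℝ) :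
    ∃ C' : ℝ, ∀ (u : H10 Ω) (t : ℝ), 0 < t → IsBoundedLimit Ω U C u →
      ∃ w : RelaxedSpace hΩ hP hμ, ‖w‖ ≤ C' ∧
        t * ‖fnL Ω u - fnL Ω (toH10 hΩ hP hμ w)‖ ^ 2 ≤ C' := by
  obtain ⟨c, hc, hcoe⟩ := exists_le_relaxedForm hΩ hP hμ ha
  obtain ⟨C₀, hC₀, hsq⟩ := IsBoundedLimit.sq_le hP ha hU hL C
  refine ⟨max C₀ √(C₀ / c), fun u t ht hu => ?_⟩
  obtain ⟨p, w, g, hpw, hw, hg, hg'⟩ := exists_resolvent hΩ hP hμ ha ht u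
  have h1 := hsq u g hu
  rw [← hw] at h1
  have h2 : c * ‖p‖ ^ 2 ≤ g w := by
    have := hcoe p
    rwa [hg, hpw] at this
  -- With `s = g w` and `P = t‖u - w‖²` the inequality becomes `(P + s)² ≤ C₀ s`, which bounds both
  -- terms by `C₀`.
  have h3 : g u = t * ‖fnL Ω u - fnL Ω w‖ ^ 2 + g w := by
    rw [hg', hg', ← real_inner_self_eq_norm_sq, inner_sub_right (fnL Ω u - fnL Ω w)]
    ring
  have h4 : 0 ≤ t * ‖fnL Ω u - fnL Ω w‖ ^ 2 := by positivity
  have h5 : 0 ≤ g w := le_trans (by positivity) h2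
  rw [h3] at h1
  obtain ⟨h6, h7⟩ := le_of_add_sq_le hC₀ h4 h5 h1
  refine ⟨p, le_trans ?_ (le_max_right _ _), le_trans ?_ (le_max_left _ _)⟩
  · refine Real.le_sqrt_of_sq_le ?_
    rw [le_div_iff₀ hc]
    linarith
  · rwa [hpw]

/-- Measures which are limits for the same sequence of open sets, possibly with different
operators, give the same space `H¹₀(Ω) ∩ L²_μ(Ω)`. -/
theorem X_subset_X (hΩ : IsOpen Ω) (hP : HasPoincare Ω) {ν : Measure (RSpace n)}
    (hμ : IsM0 Ω μ) (hν : IsM0 Ω ν) {b : Matrix (Fin n) (Fin n) ℝ} (ha : Elliptic a)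
    (hb : Elliptic b) (hU : ∀ k, IsOpen (U k) ∧ U k ⊆ Ω) (hA : IsLimitMeasure a Ω U μ)
    (hB : IsLimitMeasure b Ω U ν) : X Ω μ ⊆ X Ω ν := by
  intro ψ hψ
  obtain ⟨C, hC⟩ := exists_isBoundedLimit hΩ hP hμ ha hU hA hψ
  obtain ⟨C', hC'⟩ := IsBoundedLimit.exists_near hΩ hP hν hb hU hB C
  -- The parameter is `t = j + 1` in both approximations. Since `C` does not depend on `t`, one
  -- constant `C'` serves for all `j`.
  choose u hu hu' using fun j : ℕ => hC (j + 1) (by positivity)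
  choose w hw hw' using fun j : ℕ => hC' (u j) (j + 1) (by positivity) (hu j)
  refine mem_X_of_bounded hΩ hP hν hw ?_
  have hzero : ∀ {D : ℝ} {d : ℕ → ℝ}, (∀ j, 0 ≤ d j) → (∀ j : ℕ, ((j : ℝ) + 1) * d j ^ 2 ≤ D) →
      Tendsto d atTop (𝓝 0) := by
    intro D d hd h
    have h1 : Tendsto (fun j : ℕ => D * (1 / ((j : ℝ) + 1))) atTop (𝓝 (D * 0)) :=
      tendsto_one_div_add_atTop_nhds_zero_nat.const_mul D
    rw [mul_zero] at h1
    have h2 : Tendsto (fun j => d j ^ 2) atTop (𝓝 0) := by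
      refine squeeze_zero (fun j => sq_nonneg _) (fun j => ?_) h1
      rw [mul_one_div, le_div_iff₀ (by positivity), mul_comm]
      exact h j
    have h3 := h2.sqrt
    simp only [Real.sqrt_zero] at h3
    exact h3.congr fun j => Real.sqrt_sq (hd j)
  have l1 := hzero (fun j => norm_nonneg _) hu'
  have l2 := hzero (fun j => norm_nonneg _) hw'
  rw [tendsto_iff_norm_sub_tendsto_zero]
  refine squeeze_zero (fun _ => norm_nonneg _) (fun j => ?_) (by simpa using l2.add l1)
  rw [norm_sub_rev (fnL Ω (u j)) (fnL Ω (toH10 hΩ hP hν (w j)))]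
  exact norm_sub_le_norm_sub_add_norm_sub _ _ _

/-! ### The solution operators -/

theorem sub_mem_X (hΩ : IsOpen Ω) (hP : HasPoincare Ω) (hμ : IsM0 Ω μ) {u v : H10 Ω}
    (hu : u ∈ X Ω μ) (hv : v ∈ X Ω μ) : u - v ∈ X Ω μ := by
  obtain ⟨p, rfl⟩ := (mem_X_iff (hΩ := hΩ) (hP := hP) (hμ := hμ)).1 hu
  obtain ⟨q, rfl⟩ := (mem_X_iff (hΩ := hΩ) (hP := hP) (hμ := hμ)).1 hv
  exact mem_X_iff.2 ⟨p - q, map_sub _ _ _⟩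

/-- Elements of `H¹₀(Ω) ∩ L²_μ(Ω)` are determined by their `L²` products with that space. -/
theorem eq_of_l2Functional_eq (hΩ : IsOpen Ω) (hP : HasPoincare Ω) (hμ : IsM0 Ω μ) {u v : H10 Ω}
    (hu : u ∈ X Ω μ) (hv : v ∈ X Ω μ)
    (h : ∀ φ ∈ X Ω μ, l2Functional u φ = l2Functional v φ) : u = v := by
  have h1 := h _ (sub_mem_X hΩ hP hμ hu hv)
  rw [l2Functional_eq_inner, l2Functional_eq_inner, ← sub_eq_zero, ← inner_sub_left, map_sub,
    inner_self_eq_zero, sub_eq_zero] at h1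
  exact H10_ext h1

/-- The weak equation recovers from the solution the action of the datum on `X Ω μ`, and a datum in
`X Ω μ` can be tested with differences in that space. -/
theorem injOn_solOp (hΩ : IsOpen Ω) (hP : HasPoincare Ω) (hμ : IsM0 Ω μ) (ha : Elliptic a) :
    Set.InjOn (fun z : H10 Ω => solOp a μ (l2Functional z)) (X Ω μ) := by
  intro u hu v hv huv
  have huv : solOp a μ (l2Functional u) = solOp a μ (l2Functional v) := huv
  refine eq_of_l2Functional_eq hΩ hP hμ hu hv fun φ hφ => ?_
  rw [← (isRelaxedSol_solOp hΩ hP hμ ha (l2Functional u)).2 φ hφ, huv,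
    (isRelaxedSol_solOp hΩ hP hμ ha (l2Functional v)).2 φ hφ]

theorem Lam_solOp (hΩ : IsOpen Ω) (hP : HasPoincare Ω) (hμ : IsM0 Ω μ) (ha : Elliptic a)
    {z : H10 Ω} (hz : z ∈ X Ω μ) : Lam a μ (solOp a μ (l2Functional z)) = z :=
  (injOn_solOp hΩ hP hμ ha).leftInvOn_invFunOn hz

theorem solOp_mem_V (hΩ : IsOpen Ω) (hP : HasPoincare Ω) (hμ : IsM0 Ω μ) (ha : Elliptic a)
    {z : H10 Ω} (hz : z ∈ X Ω μ) : solOp a μ (l2Functional z) ∈ V a Ω μ :=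
  ⟨(isRelaxedSol_solOp hΩ hP hμ ha _).1, z, hz, rfl⟩

/-- The solution operator is symmetric. -/
theorem apply_solOp_comm (hΩ : IsOpen Ω) (hP : HasPoincare Ω) (hμ : IsM0 Ω μ)
    (ha : Elliptic a) (f g : Hdual Ω) : f (solOp a μ g) = g (solOp a μ f) := by
  obtain ⟨p, hp, hp'⟩ := (isRelaxedSol_iff (hΩ := hΩ) (hP := hP) (hμ := hμ)).1
    (isRelaxedSol_solOp hΩ hP hμ ha f)
  obtain ⟨q, hq, hq'⟩ := (isRelaxedSol_iff (hΩ := hΩ) (hP := hP) (hμ := hμ)).1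
    (isRelaxedSol_solOp hΩ hP hμ ha g)
  rw [← hp, ← hq, ← hp', ← hq', relaxedForm_comm]

end

end RelaxedDirichlet

end

/-! ### The single equation and the relaxed system -/

open RelaxedDirichlet in
theorem theorem5p1 (n : ℕ) (hn : 2 ≤ n) (Ω : Set (RSpace n)) (hΩ : IsOpen Ω)
    (hΩb : Bornology.IsBounded Ω)
    (a b : Matrix (Fin n) (Fin n) ℝ) (ha : Elliptic a) (hb : Elliptic b)
    (μA μB : Measure (RSpace n)) (hμA : IsM0 Ω μA) (hμB : IsM0 Ω μB)
    (U : ℕ → Set (RSpace n)) (hU : ∀ k, IsOpen (U k) ∧ U k ⊆ Ω)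
    (hA : IsLimitMeasure a Ω U μA) (hB : IsLimitMeasure b Ω U μB)
    (f : Hdual Ω) :
    -- the operators `R_A`, `R_B` are well defined
    (∀ g : Hdual Ω, ∃! w : H10 Ω, IsRelaxedSol a μA g w) ∧
    (∀ g : Hdual Ω, ∃! w : H10 Ω, IsRelaxedSol b μB g w) ∧
    -- and injective on `H¹₀ ∩ L²_μ`, so that `Λ_A`, `Λ_B` are well defined
    Set.InjOn (fun z : H10 Ω => solOp a μA (l2Functional z)) (X Ω μA) ∧
    Set.InjOn (fun z : H10 Ω => solOp b μB (l2Functional z)) (X Ω μB) ∧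
    -- the single equation is equivalent to the relaxed system
    ∀ u ∈ X Ω μA,
      ((u ∈ V a Ω μA ∧
          ∀ φ ∈ V b Ω μB, ∫ x in Ω, fn (Lam b μB φ) x * fn (Lam a μA u) x = f φ) ↔
        ∃ v : H10 Ω, IsRelaxedSol a μA (l2Functional v) u ∧ IsRelaxedSol b μB f v) := by
  have hP : HasPoincare Ω := exists_norm_fst_le (by omega) hΩb
  refine ⟨existsUnique_isRelaxedSol hΩ hP hμA ha, existsUnique_isRelaxedSol hΩ hP hμB hb,
    injOn_solOp hΩ hP hμA ha, injOn_solOp hΩ hP hμB hb, fun u _ => ⟨?_, ?_⟩⟩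
  · rintro ⟨⟨-, z, hz, rfl⟩, h⟩
    -- Here the common sequence is used: `z` comes from the space of `μA` but must be tested in that
    -- of `μB`.
    have hzB : z ∈ X Ω μB := X_subset_X hΩ hP hμA hμB ha hb hU hA hB hz
    have hv := isRelaxedSol_solOp hΩ hP hμB hb f
    have e : z = solOp b μB f := by
      refine eq_of_l2Functional_eq hΩ hP hμB hzB hv.1 fun φ hφ => ?_
      -- For `φ` in `X Ω μB`, the admissible test function is `R_B φ`; symmetry of `R_B` moves it
      -- onto `f`.
      have h1 := h _ (solOp_mem_V hΩ hP hμB hb hφ)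
      rw [Lam_solOp hΩ hP hμB hb hφ, Lam_solOp hΩ hP hμA ha hz,
        ← l2Functional_apply' hΩ.measurableSet, apply_solOp_comm hΩ hP hμB hb] at h1
      simp only [l2Functional_eq_inner] at h1 ⊢
      rw [real_inner_comm, h1, real_inner_comm]
    exact ⟨z, isRelaxedSol_solOp hΩ hP hμA ha _, e ▸ hv⟩
  · rintro ⟨v, hu, hv⟩
    have hvA : v ∈ X Ω μA := X_subset_X hΩ hP hμB hμA hb ha hU hB hA hv.1
    obtain rfl := eq_solOp hΩ hP hμA ha hu
    refine ⟨solOp_mem_V hΩ hP hμA ha hvA, ?_⟩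
    rintro φ ⟨-, z, hz, rfl⟩
    rw [Lam_solOp hΩ hP hμB hb hz, Lam_solOp hΩ hP hμA ha hvA,
      ← l2Functional_apply' hΩ.measurableSet, apply_solOp_comm hΩ hP hμB hb,
      ← eq_solOp hΩ hP hμB hb hv]
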